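/- A \emph{conditional approval profile} $P$ consists of issues $I_1,\dots,I_m$ with finite nonempty domains $D_1,\dots,D_m$, and of voters $1,\dots,n$. Voter $i$ casts a ballot, which consists of a loopless directed graph $G_i$ on the issues and, for each issue $I_j$, a set $C_{ij}$ of statements $\{t:A\}$, where $t$ assigns to each in-neighbour $I_k$ of $I_j$ in $G_i$ an alternative from $D_k$, and $A\subseteq D_j$. It is assumed that every issue is incident to an edge of some $G_i$. An \emph{outcome} is a tuple $r\in D_1\times\dots\times D_m$. Voter $i$ is satisfied with issue $I_j$ under $r$ if some $\{t:A\}\in C_{ij}$ has $r_j\in A$ and $t$ equal to the projection of $r$ to the in-neighbours of $I_j$ in $G_i$. Let $\delta_i(r)$ be the number of issues with which voter $i$ is not satisfied under $r$. The problem CMS (conditional minisum approval voting) is: given $P$ and $s\in\mathbb{N}$, find an outcome $r$ with $\sum_{i=1}^n\delta_i(r)\le s$, or report that there is none. Write $d=\max_j|D_j|$ and $|P|$ for the size of the input, in which domains and statements are listed explicitly. Running times are those of deterministic random access machines with logarithmic cost. The Strong Exponential Time Hypothesis (SETH) states that for every $\varepsilon>0$ there is a $k$ such that $k$-SAT (satisfiability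 of CNF formulas with at most $k$ literals per clause) on $\nu$ variables cannot be solved in time $(2-\varepsilon)^{\nu}$ times a polynomial in the input size. \textbf{Theorem.} If there is an $\varepsilon>0$ such that CMS can be solved in time $d^{(1-\varepsilon)m}\cdot|P|^{O(1)}$, then the SETH is false. -/

import Mathlib

/-! ## Machine model: a random access machine with logarithmic cost

A machine has finitely many registers (those named in its program) and an unbounded memory; every
register and every memory cell holds a natural number. Programs are built from the usual
arithmetic and (indirect) load / store instructions with structured control flow. Every
instruction is charged the total bit length of the numbers that it handles (operands, addresses,
cell contents). -/

namespace RAM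

/-- Programs; `x y z : ℕ` are register names. -/
inductive Prog : Type
  | skip : Prog
  | const (x c : ℕ) : Prog
  | copy (x y : ℕ) : Prog
  | add (x y z : ℕ) : Prog
  | sub (x y z : ℕ) : Prog
  | mul (x y z : ℕ) : Prog
  | div (x y z : ℕ) : Prog
  | load (x y : ℕ) : Prog
  | store (x y : ℕ) : Prog
  | seq (p q : Prog) : Prog
  | ite (x : ℕ) (p q : Prog) : Prog
  | loop (x : ℕ) (p : Prog) : Prog

/-- The contents of the registers and of the memory. -/
@[ext]
structure State : Type where
  reg : ℕ → ℕ
  mem : ℕ → ℕ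

/-- The state `σ` after writing `v` into register `x`. -/
def State.setReg (σ : State) (x v : ℕ) : State := ⟨Function.update σ.reg x v, σ.mem⟩

/-- The state `σ` after writing `v` into the memory cell with address `a`. -/
def State.setMem (σ : State) (a v : ℕ) : State := ⟨σ.reg, Function.update σ.mem a v⟩

/-- The cost of handling the number `v`: its bit length, plus one (so that `0` has a cost). -/
def len (v : ℕ) : ℕ := Nat.size v + 1

/-- `Exec p σ τ t`: started in state `σ`, the program `p` halts in state `τ`, at total cost `t`.
Subtraction is truncated at `0`, division rounds down (division by `0` gives `0`), and
a register counts as true in `ite` and `loop` (the `while` loop) iff it is not `0`. -/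
inductive Exec : Prog → State → State → ℕ → Prop
  | skip (σ : State) : Exec Prog.skip σ σ 1
  | const (σ : State) (x c : ℕ) : Exec (Prog.const x c) σ (σ.setReg x c) (len c)
  | copy (σ : State) (x y : ℕ) :
      Exec (Prog.copy x y) σ (σ.setReg x (σ.reg y)) (len (σ.reg y))
  | add (σ : State) (x y z : ℕ) :
      Exec (Prog.add x y z) σ (σ.setReg x (σ.reg y + σ.reg z)) (len (σ.reg y) + len (σ.reg z))
  | sub (σ : State) (x y z : ℕ) :
      Exec (Prog.sub x y z) σ (σ.setReg x (σ.reg y - σ.reg z)) (len (σ.reg y) + len (σ.reg z))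
  | mul (σ : State) (x y z : ℕ) :
      Exec (Prog.mul x y z) σ (σ.setReg x (σ.reg y * σ.reg z)) (len (σ.reg y) + len (σ.reg z))
  | div (σ : State) (x y z : ℕ) :
      Exec (Prog.div x y z) σ (σ.setReg x (σ.reg y / σ.reg z)) (len (σ.reg y) + len (σ.reg z))
  | load (σ : State) (x y : ℕ) :
      Exec (Prog.load x y) σ (σ.setReg x (σ.mem (σ.reg y)))
        (len (σ.reg y) + len (σ.mem (σ.reg y)))
  | store (σ : State) (x y : ℕ) :
      Exec (Prog.store x y) σ (σ.setMem (σ.reg x) (σ.reg y)) (len (σ.reg x) + len (σ.reg y))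
  | seq {p q : Prog} {σ τ υ : State} {s t : ℕ} (hp : Exec p σ τ s) (hq : Exec q τ υ t) :
      Exec (Prog.seq p q) σ υ (s + t)
  | ite_true {x : ℕ} {p q : Prog} {σ τ : State} {t : ℕ} (hx : σ.reg x ≠ 0) (hp : Exec p σ τ t) :
      Exec (Prog.ite x p q) σ τ (len (σ.reg x) + t)
  | ite_false {x : ℕ} {p q : Prog} {σ τ : State} {t : ℕ} (hx : σ.reg x = 0) (hq : Exec q σ τ t) :
      Exec (Prog.ite x p q) σ τ (len (σ.reg x) + t)
  | loop_true {x : ℕ} {p : Prog} {σ τ υ : State} {s t : ℕ} (hx : σ.reg x ≠ 0)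
      (hp : Exec p σ τ s) (hl : Exec (Prog.loop x p) τ υ t) :
      Exec (Prog.loop x p) σ υ (len (σ.reg x) + s + t)
  | loop_false {x : ℕ} {p : Prog} {σ : State} (hx : σ.reg x = 0) :
      Exec (Prog.loop x p) σ σ (len (σ.reg x))

/-- The machine is deterministic: final state and cost are determined by the initial state. -/
theorem Exec.deterministic {p : Prog} {σ τ : State} {t : ℕ} (h : Exec p σ τ t) :
    ∀ {τ' : State} {t' : ℕ}, Exec p σ τ' t' → τ = τ' ∧ t = t' := by
  induction h with
  | seq _ _ ih₁ ih₂ =>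
    intro _ _ h'
    cases h' with
    | seq h₁ h₂ =>
      obtain ⟨rfl, rfl⟩ := ih₁ h₁
      obtain ⟨rfl, rfl⟩ := ih₂ h₂
      exact ⟨rfl, rfl⟩
  | ite_true hx _ ih =>
    intro _ _ h'
    cases h' with
    | ite_true _ h₁ => obtain ⟨rfl, rfl⟩ := ih h₁; exact ⟨rfl, rfl⟩
    | ite_false hx' _ => exact absurd hx' hx
  | ite_false hx _ ih =>
    intro _ _ h'
    cases h' with
    | ite_true hx' _ => exact absurd hx hx'
    | ite_false _ h₁ => obtain ⟨rfl, rfl⟩ := ih h₁; exact ⟨rfl, rfl⟩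
  | loop_true hx _ _ ih₁ ih₂ =>
    intro _ _ h'
    cases h' with
    | loop_true _ h₁ h₂ =>
      obtain ⟨rfl, rfl⟩ := ih₁ h₁
      obtain ⟨rfl, rfl⟩ := ih₂ h₂
      exact ⟨rfl, rfl⟩
    | loop_false hx' => exact absurd hx' hx
  | loop_false hx =>
    intro _ _ h'
    cases h' with
    | loop_true hx' _ _ => exact absurd hx hx'
    | loop_false _ => exact ⟨rfl, rfl⟩
  | _ =>
    intro _ _ h'
    cases h'
    exact ⟨rfl, rfl⟩

/-- The initial state on the input word `w`: the word stands in the memory cells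
`0, 1, 2, …`; all other cells and all registers are `0`. -/
def start (w : List ℕ) : State := ⟨fun _ => 0, fun a => w.getD a 0⟩

/-- The size of an input word: the total length of its entries. -/
def wordSize (w : List ℕ) : ℕ := (w.map len).sum

end RAM

/-! ## Satisfiability and the Strong Exponential Time Hypothesis -/

namespace SAT

/-- A CNF formula on the variables `0, …, ν - 1`: a list of clauses, each a list of literals.
The literal `(v, b)` is true under an assignment `α` iff `α v = b`. -/
structure Formula : Type where
  ν : ℕ
  clauses : List (List (Fin ν × Bool))

/-- Every clause has at most `k` literals. -/
def Formula.IsKCNF (φ : Formula) (k : ℕ) : Prop := ∀ c ∈ φ.clauses, c.length ≤ k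

def Formula.Satisfiable (φ : Formula) : Prop :=
  ∃ α : Fin φ.ν → Bool, ∀ c ∈ φ.clauses, ∃ l ∈ c, α l.1 = l.2

/-- The input word of a formula: number of variables, number of clauses, and for each clause its
length followed by its literals, each as a variable and a sign. -/
def Formula.encode (φ : Formula) : List ℕ :=
  φ.ν :: φ.clauses.length ::
    φ.clauses.flatMap fun c => c.length :: c.flatMap fun l => [(l.1 : ℕ), l.2.toNat]

/-- The input size of a formula. -/
def Formula.size (φ : Formula) : ℕ := RAM.wordSize φ.encode

/-- `k`-SAT is solved by some machine within cost `T φ` on every `k`-CNF formula `φ`; the answer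
(`1` for satisfiable, `0` for unsatisfiable) is left in memory cell `0`. -/
def SolvableInTime (k : ℕ) (T : Formula → ℝ) : Prop :=
  ∃ p : RAM.Prog, ∀ φ : Formula, φ.IsKCNF k →
    ∃ (τ : RAM.State) (t : ℕ), RAM.Exec p (RAM.start φ.encode) τ t ∧ (t : ℝ) ≤ T φ ∧
      ((τ.mem 0 = 1 ∧ φ.Satisfiable) ∨ (τ.mem 0 = 0 ∧ ¬ φ.Satisfiable))

end SAT

/-- The Strong Exponential Time Hypothesis: for all `ε > 0` there is a `k` such that `k`-SAT cannot
be solved in time `(2 - ε) ^ ν` times a polynomial in the input size. -/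
def SETH : Prop :=
  ∀ ε : ℝ, 0 < ε → ∃ k : ℕ,
    ¬ ∃ C c : ℕ, SAT.SolvableInTime k fun φ => C * (2 - ε) ^ φ.ν * (φ.size : ℝ) ^ c

/-! ## Conditional approval voting -/

/-- A conditional approval ballot over `m` issues, where issue `j` has the `dom j` alternatives
`0, …, dom j - 1`: a dependency graph without loops, given by the in-neighbourhoods of the issues,
and for each issue a set (written down as a list without repetitions) of statements, each
consisting of a premise, which assigns an alternative to each in-neighbour, and
an approval set. -/
structure Ballot {m : ℕ} (dom : Fin m → ℕ) : Type where
  inNbr : Fin m → Finset (Fin m)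
  loopless : ∀ j, j ∉ inNbr j
  stmts : ∀ j : Fin m,
    List ((∀ k : {k : Fin m // k ∈ inNbr j}, Fin (dom k)) × Finset (Fin (dom j)))
  nodup : ∀ j, (stmts j).Nodup

/-- A conditional approval voting profile with `m` issues, nonempty finite domains, `n` voters. -/
structure Profile : Type where
  m : ℕ
  dom : Fin m → ℕ
  dom_pos : ∀ j, 0 < dom j
  n : ℕ
  ballot : Fin n → Ballot dom

/-- An outcome selects an alternative for each issue. -/
abbrev Outcome {m : ℕ} (dom : Fin m → ℕ) : Type := ∀ j : Fin m, Fin (dom j)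

namespace Ballot

variable {m : ℕ} {dom : Fin m → ℕ}

/-- Satisfaction with issue `j`: some statement for `j` has the projection of `r` to the
in-neighbours of `j` as its premise and approves `r j`. -/
def SatisfiedWith (B : Ballot dom) (r : Outcome dom) (j : Fin m) : Prop :=
  ∃ S ∈ B.stmts j, (∀ k : {k : Fin m // k ∈ B.inNbr j}, S.1 k = r k) ∧ r j ∈ S.2

open Classical in
/-- The number of issues that dissatisfy the voter. -/
noncomputable def dissatisfaction (B : Ballot dom) (r : Outcome dom) : ℕ :=
  (Finset.univ.filter fun j => ¬ B.SatisfiedWith r j).card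

/-- A ballot as a word: for each issue `j`, the indicator vector of the in-neighbours of `j`, the
number of statements for `j`, and for each statement its premise (padded by `0` outside the
in-neighbours) and the indicator vector of its approval set. -/
def encode (B : Ballot dom) : List ℕ :=
  (List.finRange m).flatMap fun j =>
    (List.ofFn fun k : Fin m => if k ∈ B.inNbr j then 1 else 0) ++
    (B.stmts j).length ::
    (B.stmts j).flatMap fun S =>
      (List.ofFn fun k : Fin m => if h : k ∈ B.inNbr j then (S.1 ⟨k, h⟩ : ℕ) else 0) ++
      (List.ofFn fun a : Fin (dom j) => if a ∈ S.2 then 1 else 0)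

end Ballot

namespace Profile

/-- The maximum domain size. -/
def d (P : Profile) : ℕ := Finset.univ.sup P.dom

/-- The total number of disagreements over all voters. -/
noncomputable def cost (P : Profile) (r : Outcome P.dom) : ℕ :=
  ∑ i, (P.ballot i).dissatisfaction r

/-- The global dependency graph: the union of the voters' graphs, with directions forgotten. -/
def globalGraph (P : Profile) : SimpleGraph (Fin P.m) :=
  SimpleGraph.fromRel fun k j => ∃ i, k ∈ (P.ballot i).inNbr j

/-- The global dependency graph has minimum degree at least `1`. -/
def NoIsolatedIssue (P : Profile) : Prop := ∀ j, ∃ k, P.globalGraph.Adj j k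

/-- The input word of a profile with a target `s`: the numbers of issues and of voters, `s`, for
each issue the size of its domain followed by a listing of the domain, and the ballots. -/
def encode (P : Profile) (s : ℕ) : List ℕ :=
  P.m :: P.n :: s ::
    (((List.finRange P.m).flatMap fun j => P.dom j :: List.range (P.dom j)) ++
      (List.finRange P.n).flatMap fun i => (P.ballot i).encode)

/-- The input size of a profile with a target `s`. -/
def size (P : Profile) (s : ℕ) : ℕ := RAM.wordSize (P.encode s)

end Profile

namespace CMS

/-- Conditional minisum approval voting is solved by some machine within cost `T P s` on every
profile `P` without isolated issues and every target `s`. If some outcome has at most `s`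
disagreements, the machine leaves `1` in memory cell `0` and such an outcome in
the cells `1, …, m`; otherwise it leaves `0` in cell `0`. -/
def SolvableInTime (T : Profile → ℕ → ℝ) : Prop :=
  ∃ p : RAM.Prog, ∀ (P : Profile) (s : ℕ), P.NoIsolatedIssue →
    ∃ (τ : RAM.State) (t : ℕ), RAM.Exec p (RAM.start (P.encode s)) τ t ∧ (t : ℝ) ≤ T P s ∧
      ((τ.mem 0 = 1 ∧ ∃ r : Outcome P.dom, (∀ j : Fin P.m, τ.mem (j + 1) = r j) ∧ P.cost r ≤ s) ∨
        (τ.mem 0 = 0 ∧ ∀ r : Outcome P.dom, s < P.cost r))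

end CMS

/-! Satisfiability of a CNF formula on `ν` variables reduces in polynomial time to CMS with `ν + 2`
binary issues. So `d = 2`, and a bound `d ^ ((1 - ε) m)` becomes a constant times `(2 ^ (1 - ε)) ^
ν`, with base below `2`. The clause width plays no role.

Issues `1, …, ν` are the variables, and voters have statements for issue `0` only. For a clause `l₁
∨ … ∨ l_q` there is one voter per literal: the `i`-th approves everything on issue `0` iff `l₁, …,
l_{i-1}` are false and `l_i` is true. These conditions exclude each other, and one of them holds iff
the clause is true. Each needs a single statement, whereas one voter per clause would need
exponentially many in the clause width. Hence the number of voters satisfied with issue `0` is the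
number of true clauses (`agreeing_voters_append`, `agreeing_foldl`). All other issues dissatisfy
every voter, so the total cost is `n (ν + 2)` minus that number, and the target `n (ν + 2) -
#clauses` is met iff all clauses are true (`cost_le_target_iff`). Voters that approve nothing, one
for each end of a clause and one more, serve only to make every issue incident to an edge.

The reduction must also run on the machine. `reduction` reads the formula while erasing it, keeping
it as the digits of one large number, then writes the profile from address `0` on and clears all
else. It ends exactly in the start state on the encoded profile (`exec_reduction`), so a program for
CMS can follow it. The large number has polynomially many bits, so logarithmic costs stay
polynomial. Finally, polynomial factors in `ν` are absorbed by a base slightly larger but still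
below `2` (`exists_pow_mul_pow_le`). -/

namespace RAM

/-! ### Cost bounds for programs on finitely many registers -/

/-- A state in which only the registers listed may be nonzero. -/
abbrev Conf : Type := List ℕ × (ℕ → ℕ)

def Conf.toState (s : Conf) : State := ⟨fun i => s.1.getD i 0, s.2⟩

/-- `p` leads from `s` to `s'` within cost `n` times the cost of an instruction on numbers of
size at most `V`. -/
def Run (V n : ℕ) (p : Prog) (s s' : Conf) : Prop :=
  ∃ t, Exec p s.toState s'.toState t ∧ t ≤ n * (2 * len V)

theorem len_mono {a b : ℕ} (h : a ≤ b) : len a ≤ len b :=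
  Nat.succ_le_succ (Nat.size_le_size h)

theorem one_le_len (a : ℕ) : 1 ≤ len a := Nat.succ_le_succ (Nat.zero_le _)

theorem Run.mono {V n n' : ℕ} {p : Prog} {s s' : Conf} (h : Run V n p s s') (hn : n ≤ n') :
    Run V n' p s s' := by
  obtain ⟨t, h, ht⟩ := h
  exact ⟨t, h, ht.trans (Nat.mul_le_mul_right _ hn)⟩

theorem Run.seq {V n n' : ℕ} {p q : Prog} {s s' s'' : Conf} (h : Run V n p s s')
    (h' : Run V n' q s' s'') : Run V (n + n') (Prog.seq p q) s s'' := by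
  obtain ⟨t, h, ht⟩ := h
  obtain ⟨t', h', ht'⟩ := h'
  exact ⟨t + t', h.seq h', by rw [add_mul]; omega⟩

theorem Run.loop_false {V x : ℕ} {p : Prog} {s : Conf} (hx : s.1.getD x 0 = 0) :
    Run V 1 (Prog.loop x p) s s := by
  refine ⟨_, Exec.loop_false hx, ?_⟩
  have : len (s.toState.reg x) = 1 := by
    change len (s.1.getD x 0) = 1
    rw [hx]; rfl
  have := one_le_len V
  omega

theorem Run.loop_true {V n n' x : ℕ} {p : Prog} {s s' s'' : Conf} (hx : s.1.getD x 0 ≠ 0)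
    (hV : s.1.getD x 0 ≤ V) (h : Run V n p s s') (h' : Run V n' (Prog.loop x p) s' s'') :
    Run V (n + n' + 1) (Prog.loop x p) s s'' := by
  obtain ⟨t, h, ht⟩ := h
  obtain ⟨t', h', ht'⟩ := h'
  refine ⟨_, Exec.loop_true hx h h', ?_⟩
  have : len (s.toState.reg x) ≤ len V := len_mono hV
  rw [add_mul, add_mul]
  omega

theorem Run.ite_true {V n x : ℕ} {p q : Prog} {s s' : Conf} (hx : s.1.getD x 0 ≠ 0)
    (hV : s.1.getD x 0 ≤ V) (h : Run V n p s s') : Run V (n + 1) (Prog.ite x p q) s s' := by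
  obtain ⟨t, h, ht⟩ := h
  refine ⟨_, Exec.ite_true hx h, ?_⟩
  have : len (s.toState.reg x) ≤ len V := len_mono hV
  rw [add_mul]
  omega

theorem Run.ite_false {V n x : ℕ} {p q : Prog} {s s' : Conf} (hx : s.1.getD x 0 = 0)
    (h : Run V n q s s') : Run V (n + 1) (Prog.ite x p q) s s' := by
  obtain ⟨t, h, ht⟩ := h
  refine ⟨_, Exec.ite_false hx h, ?_⟩
  have : len (s.toState.reg x) ≤ len V := len_mono (by
    change s.1.getD x 0 ≤ V
    omega)
  rw [add_mul]
  omega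

/-- The effect of an instruction. -/
def step : Prog → Conf → Conf
  | .const x c, s => (s.1.set x c, s.2)
  | .copy x y, s => (s.1.set x (s.1.getD y 0), s.2)
  | .add x y z, s => (s.1.set x (s.1.getD y 0 + s.1.getD z 0), s.2)
  | .sub x y z, s => (s.1.set x (s.1.getD y 0 - s.1.getD z 0), s.2)
  | .mul x y z, s => (s.1.set x (s.1.getD y 0 * s.1.getD z 0), s.2)
  | .div x y z, s => (s.1.set x (s.1.getD y 0 / s.1.getD z 0), s.2)
  | .load x y, s => (s.1.set x (s.2 (s.1.getD y 0)), s.2)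
  | .store x y, s => (s.1, Function.update s.2 (s.1.getD x 0) (s.1.getD y 0))
  | _, s => s

/-- An instruction that writes into a listed register and handles numbers up to `V` only. -/
def Ok (V : ℕ) : Prog → Conf → Prop
  | .const x c, s => x < s.1.length ∧ c ≤ V
  | .copy x y, s => x < s.1.length ∧ s.1.getD y 0 ≤ V
  | .add x y z, s => x < s.1.length ∧ s.1.getD y 0 ≤ V ∧ s.1.getD z 0 ≤ V
  | .sub x y z, s => x < s.1.length ∧ s.1.getD y 0 ≤ V ∧ s.1.getD z 0 ≤ V
  | .mul x y z, s => x < s.1.length ∧ s.1.getD y 0 ≤ V ∧ s.1.getD z 0 ≤ V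
  | .div x y z, s => x < s.1.length ∧ s.1.getD y 0 ≤ V ∧ s.1.getD z 0 ≤ V
  | .load x y, s => x < s.1.length ∧ s.1.getD y 0 ≤ V ∧ s.2 (s.1.getD y 0) ≤ V
  | .store x y, s => s.1.getD x 0 ≤ V ∧ s.1.getD y 0 ≤ V
  | _, _ => False

/-- The bound on `x` is essential: `List.set` past the end changes nothing, whereas the machine
would change the register. -/
theorem setReg_toState (l : List ℕ) (M : ℕ → ℕ) {x : ℕ} (v : ℕ) (hx : x < l.length) :
    (Conf.toState (l, M)).setReg x v = Conf.toState (l.set x v, M) := by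
  ext i
  · by_cases h : i = x
    · subst h
      simp [Conf.toState, State.setReg, hx]
    · simp [Conf.toState, State.setReg, h, List.getElem?_set_ne (Ne.symm h)]
  · rfl

theorem Run.step {V : ℕ} {p : Prog} {s : Conf} (h : Ok V p s) : Run V 1 p s (step p s) := by
  obtain ⟨l, M⟩ := s
  have key : ∀ {x v t : ℕ}, x < l.length → t ≤ 2 * len V →
      Exec p (Conf.toState (l, M)) ((Conf.toState (l, M)).setReg x v) t →
      Run V 1 p (l, M) (l.set x v, M) := by
    intro x v t hx ht h
    rw [setReg_toState l M v hx] at h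
    exact ⟨t, h, by omega⟩
  cases p with
  | const x c =>
    have := len_mono h.2
    exact key h.1 (by omega) (Exec.const _ x c)
  | copy x y =>
    have := len_mono h.2
    exact key h.1 (by change len (l.getD y 0) ≤ _; dsimp only at this; omega) (Exec.copy _ x y)
  | add x y z =>
    have h1 := len_mono h.2.1
    have h2 := len_mono h.2.2
    exact key h.1 (by change len (l.getD y 0) + len (l.getD z 0) ≤ _; dsimp only at h1 h2; omega)
      (Exec.add _ x y z)
  | sub x y z =>
    have h1 := len_mono h.2.1
    have h2 := len_mono h.2.2
    exact key h.1 (by change len (l.getD y 0) + len (l.getD z 0) ≤ _; dsimp only at h1 h2; omega)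
      (Exec.sub _ x y z)
  | mul x y z =>
    have h1 := len_mono h.2.1
    have h2 := len_mono h.2.2
    exact key h.1 (by change len (l.getD y 0) + len (l.getD z 0) ≤ _; dsimp only at h1 h2; omega)
      (Exec.mul _ x y z)
  | div x y z =>
    have h1 := len_mono h.2.1
    have h2 := len_mono h.2.2
    exact key h.1 (by change len (l.getD y 0) + len (l.getD z 0) ≤ _; dsimp only at h1 h2; omega)
      (Exec.div _ x y z)
  | load x y =>
    have h1 := len_mono h.2.1
    have h2 := len_mono h.2.2
    exact key h.1 (by change len (l.getD y 0) + len (M (l.getD y 0)) ≤ _; dsimp only at h1 h2; omega)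
      (Exec.load _ x y)
  | store x y =>
    have h1 := len_mono h.1
    have h2 := len_mono h.2
    refine ⟨_, Exec.store _ x y, ?_⟩
    change len (l.getD x 0) + len (l.getD y 0) ≤ _
    dsimp only at h1 h2
    omega
  | skip => exact h.elim
  | seq _ _ => exact h.elim
  | ite _ _ _ => exact h.elim
  | loop _ _ => exact h.elim

/-- The sequential composition of a list of programs. -/
def block : List Prog → Prog
  | [] => Prog.skip
  | p :: ps => Prog.seq p (block ps)

def steps : List Prog → Conf → Conf
  | [], s => s
  | p :: ps, s => steps ps (step p s)

def OkAll (V : ℕ) : List Prog → Conf → Prop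
  | [], _ => True
  | p :: ps, s => Ok V p s ∧ OkAll V ps (step p s)

theorem Run.skip {V : ℕ} (s : Conf) : Run V 1 Prog.skip s s :=
  ⟨1, Exec.skip _, by have := one_le_len V; omega⟩

/-- Straight-line code is verified by symbolic evaluation: a size condition for each instruction and
one equation between configurations. -/
theorem Run.block {V : ℕ} {ps : List Prog} {s s' : Conf} (h : OkAll V ps s)
    (hs : steps ps s = s') : Run V (ps.length + 1) (block ps) s s' := by
  induction ps generalizing s with
  | nil => subst hs; exact Run.skip _
  | cons p ps ih => exact ((Run.step h.1).seq (ih h.2 hs)).mono (by simp; omega)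

end RAM

/-! ## The reduction from CNF satisfiability -/

namespace Reduction

/-! ### Ballots with a single statement, and their encoding -/

/-- A partial assignment of the issues, where `0` stands for unassigned and `x + 1` for the
alternative `x`, together with a flag. -/
abbrev Partial : Type := (ℕ → ℕ) × ℕ

/-- On issue `0`, the voter approves everything iff the flag is set and the outcome extends the
partial assignment; all other issues dissatisfy the voter. -/
def ballotOf (ν : ℕ) (x : Partial) : Ballot fun _ : Fin (ν + 2) => 2 where
  inNbr j := if j = 0 then Finset.univ.filter fun k => k ≠ 0 ∧ x.1 k ≠ 0 else ∅
  loopless j := by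
    split_ifs with h
    · simp [h]
    · simp
  stmts j := if j = 0 then
    [(fun k => Fin.ofNat 2 (x.1 k - 1), if x.2 = 0 then ∅ else Finset.univ)] else []
  nodup j := by split_ifs <;> simp

/-- Issue `ν + 1` is no variable. It gives issue `0` a neighbour when `ν = 0`. -/
def profileOf (ν : ℕ) (vs : List Partial) : Profile where
  m := ν + 2
  dom _ := 2
  dom_pos _ := Nat.two_pos
  n := vs.length
  ballot i := ballotOf ν vs[i]

/-- The word that encodes `ballotOf ν x`. -/
def blockOf (ν : ℕ) (x : Partial) : List ℕ :=
  (List.range (ν + 2)).map (fun k => min (x.1 k) 1) ++ 1 ::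
    ((List.range (ν + 2)).map (fun k => x.1 k - 1) ++ x.2 :: x.2 ::
      List.replicate ((ν + 1) * (ν + 3)) 0)

structure Partial.WF (ν : ℕ) (x : Partial) : Prop where
  zero : x.1 0 = 0
  le_two : ∀ k, x.1 k ≤ 2
  bound : ∀ k, ν + 1 < k → x.1 k = 0
  flag : x.2 ≤ 1

theorem ofFn_eq_map_range (m : ℕ) (f : ℕ → ℕ) :
    List.ofFn (fun k : Fin m => f k) = (List.range m).map f := by
  apply List.ext_getElem <;> simp

theorem flatMap_const_replicate {α : Type*} (l : List α) (m : ℕ) :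
    l.flatMap (fun _ => List.replicate m 0) = List.replicate (l.length * m) 0 := by
  induction l with
  | nil => simp
  | cons a l ih =>
    rw [List.flatMap_cons, ih, List.replicate_append_replicate, List.length_cons]
    congr 1; ring

theorem stmts_ballotOf_zero (ν : ℕ) (x : Partial) : (ballotOf ν x).stmts 0 =
    [(fun k : {k : Fin (ν + 2) // k ∈ (ballotOf ν x).inNbr 0} => Fin.ofNat 2 (x.1 k - 1),
      if x.2 = 0 then ∅ else Finset.univ)] := by
  simp [ballotOf]

theorem encode_ballotOf {ν : ℕ} {x : Partial} (hx : x.WF ν) :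
    (ballotOf ν x).encode = blockOf ν x := by
  have h0 := hx.zero
  have h2 := hx.le_two
  have h3 := hx.flag
  -- Each issue other than `0` contributes `ν + 2` zeros for its empty in-neighbourhood and one for
  -- its number of statements.
  have hs : (List.finRange (ν + 1)).flatMap
      (fun j => (List.ofFn fun k : Fin (ν + 2) =>
          if k ∈ (ballotOf ν x).inNbr j.succ then 1 else 0) ++
        ((ballotOf ν x).stmts j.succ).length ::
        ((ballotOf ν x).stmts j.succ).flatMap fun S =>
          (List.ofFn fun k : Fin (ν + 2) =>
            if h : k ∈ (ballotOf ν x).inNbr j.succ then (S.1 ⟨k, h⟩ : ℕ) else 0) ++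
          (List.ofFn fun a : Fin 2 => if a ∈ S.2 then 1 else 0)) =
      List.replicate ((ν + 1) * (ν + 3)) 0 := by
    have h := flatMap_const_replicate (List.finRange (ν + 1)) (ν + 3)
    rw [List.length_finRange] at h
    rw [← h]
    congr 1
    funext j
    simp [ballotOf, Fin.succ_ne_zero, List.ofFn_const, ← List.replicate_succ']
    rfl
  have e1 : (List.ofFn fun k : Fin (ν + 2) => if k ∈ (ballotOf ν x).inNbr 0 then 1 else 0) =
      (List.range (ν + 2)).map (fun k => min (x.1 k) 1) := by
    rw [← ofFn_eq_map_range]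
    congr 1
    funext k
    by_cases hk : k = 0
    · subst hk; simp [ballotOf, h0]
    · simp only [ballotOf, if_true, Finset.mem_filter, Finset.mem_univ, true_and]
      split_ifs with h
      · have := h.2; omega
      · have : x.1 k = 0 := by by_contra h'; exact h ⟨hk, h'⟩
        omega
  have e2 : ∀ S : (∀ k : {k : Fin (ν + 2) // k ∈ (ballotOf ν x).inNbr 0}, Fin 2) × Finset (Fin 2),
      (∀ k, (S.1 k : ℕ) = x.1 k - 1) →
      (List.ofFn fun k : Fin (ν + 2) =>
        if h : k ∈ (ballotOf ν x).inNbr 0 then (S.1 ⟨k, h⟩ : ℕ) else 0) =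
      (List.range (ν + 2)).map (fun k => x.1 k - 1) := by
    intro S hS
    rw [← ofFn_eq_map_range]
    congr 1
    funext k
    split_ifs with h
    · rw [hS]
    · simp only [ballotOf, if_true, Finset.mem_filter, Finset.mem_univ, true_and] at h
      by_cases hk : k = 0
      · subst hk; simp [h0]
      · have : x.1 k = 0 := by by_contra h'; exact h ⟨hk, h'⟩
        omega
  -- The flag itself is the approval bit of both alternatives.
  have e3 : (List.ofFn fun a : Fin 2 =>
      if a ∈ (if x.2 = 0 then (∅ : Finset (Fin 2)) else Finset.univ) then 1 else 0) =
      [x.2, x.2] := by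
    rcases Nat.le_one_iff_eq_zero_or_eq_one.1 h3 with h | h <;> simp [h]
  unfold Ballot.encode
  rw [List.finRange_succ, List.flatMap_cons, List.flatMap_map, hs, e1]
  rw [stmts_ballotOf_zero, List.flatMap_cons, e2 _ (by
    intro k
    have := h2 k
    simp only [Fin.ofNat]
    omega), e3]
  simp [blockOf]

theorem encode_profileOf {ν : ℕ} {vs : List Partial} (hvs : ∀ x ∈ vs, x.WF ν) (s : ℕ) :
    (profileOf ν vs).encode s = (ν + 2) :: vs.length :: s ::
      ((List.replicate (ν + 2) [2, 0, 1]).flatten ++ vs.flatMap (blockOf ν)) := by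
  have e1 : (List.finRange (ν + 2)).flatMap (fun _ => 2 :: List.range 2) =
      (List.replicate (ν + 2) [2, 0, 1]).flatten := by
    rw [List.flatMap, List.map_const', List.length_finRange]
    rfl
  have e2 : (List.finRange vs.length).flatMap (fun i => (ballotOf ν vs[i]).encode) =
      vs.flatMap (blockOf ν) := by
    have h : vs = (List.finRange vs.length).map fun i => vs[i] := by
      apply List.ext_getElem <;> simp
    conv_rhs => rw [h, List.flatMap_map]
    congr 1
    funext i
    exact encode_ballotOf (hvs _ (List.getElem_mem _))
  unfold Profile.encode
  rw [← e1, ← e2]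
  rfl

theorem length_blockOf (ν : ℕ) (x : Partial) :
    (blockOf ν x).length = 2 * (ν + 2) + 3 + (ν + 1) * (ν + 3) := by
  simp [blockOf]; ring

theorem length_flatMap_blockOf (ν : ℕ) (vs : List Partial) :
    (vs.flatMap (blockOf ν)).length = vs.length * (2 * (ν + 2) + 3 + (ν + 1) * (ν + 3)) := by
  simp [List.length_flatMap, length_blockOf]

/-! ### Dissatisfaction and agreement -/

/-- The flag is set and the outcome extends the partial assignment. -/
def Agrees {ν : ℕ} (r : Fin (ν + 2) → Fin 2) (x : Partial) : Prop :=
  x.2 ≠ 0 ∧ ∀ k : Fin (ν + 2), x.1 k ≠ 0 → (r k : ℕ) + 1 = x.1 k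

theorem satisfiedWith_zero_iff {ν : ℕ} {x : Partial} (hx : x.WF ν) (r : Fin (ν + 2) → Fin 2) :
    (ballotOf ν x).SatisfiedWith r 0 ↔ Agrees r x := by
  have h2 := hx.le_two
  have h0 := hx.zero
  unfold Ballot.SatisfiedWith Agrees
  rw [stmts_ballotOf_zero]
  simp only [List.mem_singleton, exists_eq_left]
  rw [and_comm]
  refine and_congr (by split_ifs with h <;> simp [h]) ?_
  have key : ∀ k : Fin (ν + 2), x.1 k ≠ 0 →
      (Fin.ofNat 2 (x.1 k - 1) = r k ↔ (r k : ℕ) + 1 = x.1 k) := by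
    intro k hk
    have := h2 k
    have := (r k).isLt
    rw [Fin.ext_iff]
    simp only [Fin.ofNat]
    omega
  constructor
  · intro h k hk
    have hk0 : k ≠ 0 := by rintro rfl; exact hk h0
    exact (key k hk).1 (h ⟨k, by simp [ballotOf, hk, hk0]⟩)
  · rintro h ⟨k, hk⟩
    have hk' : x.1 k ≠ 0 := by
      simp only [ballotOf, if_true, Finset.mem_filter] at hk
      exact hk.2.2
    exact (key k hk').2 (h k hk')

theorem not_satisfiedWith_succ {ν : ℕ} (x : Partial) (r : Fin (ν + 2) → Fin 2) (j : Fin (ν + 1)) :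
    ¬ (ballotOf ν x).SatisfiedWith r j.succ := by
  unfold Ballot.SatisfiedWith
  have e4 : (ballotOf ν x).stmts j.succ = [] := by simp [ballotOf, Fin.succ_ne_zero]
  rw [e4]
  simp

-- Issues without statements always dissatisfy, so the outcome matters at issue `0` only.
open Classical in
theorem dissatisfaction_ballotOf {ν : ℕ} {x : Partial} (hx : x.WF ν) (r : Fin (ν + 2) → Fin 2) :
    (ballotOf ν x).dissatisfaction r + (if Agrees r x then 1 else 0) = ν + 2 := by
  unfold Ballot.dissatisfaction
  have hs : ∀ j : Fin (ν + 2), (ballotOf ν x).SatisfiedWith r j ↔ j = 0 ∧ Agrees r x := by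
    refine Fin.cases ?_ fun j => ?_
    · simp [satisfiedWith_zero_iff hx]
    · simp [not_satisfiedWith_succ, Fin.succ_ne_zero]
  simp only [hs]
  by_cases h : Agrees r x <;> simp [h, Finset.filter_ne']

open Classical in
/-- The number of partial assignments in the list that agree with the outcome. -/
noncomputable def agreeing {ν : ℕ} (r : Fin (ν + 2) → Fin 2) (vs : List Partial) : ℕ :=
  (vs.map fun x => if Agrees r x then 1 else 0).sum

theorem cost_profileOf {ν : ℕ} {vs : List Partial} (hvs : ∀ x ∈ vs, x.WF ν)
    (r : Fin (ν + 2) → Fin 2) :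
    (profileOf ν vs).cost r + agreeing r vs = vs.length * (ν + 2) := by
  classical
  have e : agreeing r vs = ∑ i : Fin vs.length, if Agrees r vs[i] then 1 else 0 := by
    unfold agreeing
    rw [← Fin.sum_univ_fun_getElem]
    rfl
  have e' : (profileOf ν vs).cost r =
      ∑ i : Fin vs.length, (ballotOf ν vs[i]).dissatisfaction r := rfl
  have h : ∀ i : Fin vs.length,
      (ballotOf ν vs[i]).dissatisfaction r + (if Agrees r vs[i] then 1 else 0) = ν + 2 :=
    fun i => dissatisfaction_ballotOf (hvs _ (List.getElem_mem _)) r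
  rw [e, e', ← Finset.sum_add_distrib]
  simp only [h]
  simp

/-! ### From literals to voters -/

/-- The token of the literal `(v, b)`; the token `0` ends a clause. -/
def token {ν : ℕ} (l : Fin ν × Bool) : ℕ := 2 * (l.1 : ℕ) + l.2.toNat + 2

/-- The list is a stack: the terminator is pushed before the literals so that it is popped after
them. Clauses and literals come out in reverse order, which is harmless. -/
def pushClause {ν : ℕ} (acc : List ℕ) (c : List (Fin ν × Bool)) : List ℕ :=
  c.foldl (fun a l => token l :: a) (0 :: acc)

/-- The initial `[0]` provides a terminator even if there are no clauses. -/
def tokens (φ : SAT.Formula) : List ℕ := φ.clauses.foldl pushClause [0]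

/-- The voter for a token, given the partial assignment that falsifies the literals read so far
(with the flag cleared if there is none). -/
def voter (ν : ℕ) (x : Partial) (t : ℕ) : Partial :=
  -- A terminator yields a voter that approves nothing but has edges from all other issues to issue
  -- `0`.
  if t / 2 = 0 then (fun k => if 1 ≤ k ∧ k ≤ ν + 1 then 1 else x.1 k, 0)
  -- An entry `2 - t % 2` means that the same literal occurred earlier in the clause and is assumed
  -- false.
  else (Function.update x.1 (t / 2) (t % 2 + 1), if x.1 (t / 2) = 2 - t % 2 then 0 else x.2)

/-- The literal is now assumed false. An old entry `t % 2 + 1` comes from the complementary literal;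
no assignment falsifies both, so the flag is cleared. A terminator starts afresh. -/
def next (ν : ℕ) (x : Partial) (t : ℕ) : Partial :=
  if t / 2 = 0 then (fun k => if 1 ≤ k ∧ k ≤ ν + 1 then 0 else x.1 k, 1)
  else (Function.update x.1 (t / 2) (2 - t % 2), if x.1 (t / 2) = t % 2 + 1 then 0 else x.2)

def voters (ν : ℕ) : Partial → List ℕ → List Partial
  | _, [] => []
  | x, t :: l => voter ν x t :: voters ν (next ν x t) l

theorem length_voters (ν : ℕ) (x : Partial) (l : List ℕ) : (voters ν x l).length = l.length := by
  induction l generalizing x with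
  | nil => rfl
  | cons t l ih => simp [voters, ih]

theorem Partial.WF.voter {ν t : ℕ} {x : Partial} (hx : x.WF ν) (ht : t ≤ 2 * ν + 1) :
    (voter ν x t).WF ν := by
  have h0 := hx.zero
  have h2 := hx.le_two
  have hb := hx.bound
  have hf := hx.flag
  unfold Reduction.voter
  split_ifs with h
  · constructor <;> simp only
    · simp [h0]
    · intro k; have := h2 k; split_ifs <;> omega
    · intro k hk; rw [if_neg (by omega), hb k hk]
    · omega
  all_goals
    constructor <;> simp only
    · rw [Function.update_of_ne (Ne.symm h), h0]
    · intro k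
      by_cases hk : k = t / 2
      · subst hk; rw [Function.update_self]; omega
      · rw [Function.update_of_ne hk]; exact h2 k
    · intro k hk
      rw [Function.update_of_ne (by omega), hb k hk]
    · omega

theorem Partial.WF.next {ν t : ℕ} {x : Partial} (hx : x.WF ν) (ht : t ≤ 2 * ν + 1) :
    (next ν x t).WF ν := by
  have h0 := hx.zero
  have h2 := hx.le_two
  have hb := hx.bound
  have hf := hx.flag
  unfold Reduction.next
  split_ifs with h
  · constructor <;> simp only
    · simp [h0]
    · intro k; have := h2 k; split_ifs <;> omega
    · intro k hk; rw [if_neg (by omega), hb k hk]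
    · omega
  all_goals
    constructor <;> simp only
    · rw [Function.update_of_ne (Ne.symm h), h0]
    · intro k
      by_cases hk : k = t / 2
      · subst hk; rw [Function.update_self]; omega
      · rw [Function.update_of_ne hk]; exact h2 k
    · intro k hk
      rw [Function.update_of_ne (by omega), hb k hk]
    · omega

theorem Partial.WF.voters {ν : ℕ} {x : Partial} (hx : x.WF ν) {l : List ℕ}
    (hl : ∀ t ∈ l, t ≤ 2 * ν + 1) : ∀ y ∈ voters ν x l, y.WF ν := by
  induction l generalizing x with
  | nil => simp [Reduction.voters]
  | cons t l ih =>
    intro y hy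
    have ht := hl t (by simp)
    rcases List.mem_cons.1 hy with rfl | hy
    · exact hx.voter ht
    · exact ih (hx.next ht) (fun t' h' => hl t' (by simp [h'])) y hy

/-- The empty assignment. -/
def blank : Partial := (fun _ => 0, 1)

theorem wf_blank (ν : ℕ) : blank.WF ν := by
  constructor <;> simp [blank]

theorem next_of_lt_two {ν t : ℕ} {x : Partial} (hx : x.WF ν) (ht : t / 2 = 0) :
    next ν x t = blank := by
  unfold next
  rw [if_pos ht, blank]
  congr 1
  funext k
  split_ifs with h
  · rfl
  · rcases Nat.eq_zero_or_pos k with rfl | hk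
    · exact hx.zero
    · exact hx.bound k (by omega)

section
variable {ν : ℕ} (r : Fin (ν + 2) → Fin 2)

/-- The literal is true under the outcome. -/
def LitTrue (l : Fin ν × Bool) : Prop := (r ⟨l.1 + 1, by omega⟩ : ℕ) = l.2.toNat

theorem agrees_update_iff (x : Partial) (f y : ℕ) (q : Fin (ν + 2)) :
    Agrees r (Function.update x.1 q (y + 1), f) ↔
      f ≠ 0 ∧ (r q : ℕ) = y ∧ ∀ k : Fin (ν + 2), k ≠ q → x.1 k ≠ 0 → (r k : ℕ) + 1 = x.1 k := by
  unfold Agrees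
  refine and_congr_right fun _ => ⟨fun h => ⟨?_, fun k hk hx => ?_⟩, fun ⟨h, h'⟩ k hk => ?_⟩
  · have := h q (by simp)
    simpa using this
  · have := h k
    simp only at this
    rw [Function.update_of_ne (by rwa [Ne, Fin.val_inj])] at this
    exact this hx
  · by_cases hq : k = q
    · subst hq; simp [h]
    · simp only at hk ⊢
      rw [Function.update_of_ne (by rwa [Ne, Fin.val_inj])] at hk ⊢
      exact h' k hq hk

theorem agrees_iff (x : Partial) (q : Fin (ν + 2)) :
    Agrees r x ↔ x.2 ≠ 0 ∧ (x.1 q ≠ 0 → (r q : ℕ) + 1 = x.1 q) ∧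
      ∀ k : Fin (ν + 2), k ≠ q → x.1 k ≠ 0 → (r k : ℕ) + 1 = x.1 k := by
  unfold Agrees
  refine and_congr_right fun _ => ⟨fun h => ⟨h q, fun k _ => h k⟩, fun ⟨h, h'⟩ k => ?_⟩
  by_cases hq : k = q
  · subst hq; exact h
  · exact h' k hq

theorem token_div (l : Fin ν × Bool) : token l / 2 = l.1 + 1 := by
  unfold token
  have := Bool.toNat_lt l.2
  omega

theorem token_mod (l : Fin ν × Bool) : token l % 2 = l.2.toNat := by
  unfold token
  have := Bool.toNat_lt l.2
  omega

theorem agrees_voter_iff {x : Partial} (hx : x.WF ν) (l : Fin ν × Bool) :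
    Agrees r (voter ν x (token l)) ↔ Agrees r x ∧ LitTrue r l := by
  obtain ⟨v, b⟩ := l
  have h2 := hx.le_two (v + 1)
  unfold voter LitTrue
  rw [token_div, token_mod, if_neg (by omega)]
  simp only
  obtain ⟨q, hq⟩ : ∃ q : Fin (ν + 2), (⟨v + 1, by omega⟩ : Fin (ν + 2)) = q := ⟨_, rfl⟩
  have hq' : (v : ℕ) + 1 = q := by rw [← hq]
  rw [hq, hq']
  rw [hq'] at h2
  rw [agrees_update_iff, agrees_iff r x q]
  have hr := (r q).isLt
  have hb := Bool.toNat_lt b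
  -- Both sides share the condition on the other issues; the rest is a finite check at `q`.
  generalize (∀ k : Fin (ν + 2), k ≠ q → x.1 k ≠ 0 → (r k : ℕ) + 1 = x.1 k) = A
  by_cases hA : A <;> simp only [hA, and_true, and_false, false_and]
  split_ifs with h <;> omega

theorem agrees_next_iff {x : Partial} (hx : x.WF ν) (l : Fin ν × Bool) :
    Agrees r (next ν x (token l)) ↔ Agrees r x ∧ ¬ LitTrue r l := by
  obtain ⟨v, b⟩ := l
  have h2 := hx.le_two (v + 1)
  have hb := Bool.toNat_lt b
  unfold next LitTrue
  rw [token_div, token_mod, if_neg (by omega), show 2 - b.toNat = (1 - b.toNat) + 1 by omega]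
  simp only
  obtain ⟨q, hq⟩ : ∃ q : Fin (ν + 2), (⟨v + 1, by omega⟩ : Fin (ν + 2)) = q := ⟨_, rfl⟩
  have hq' : (v : ℕ) + 1 = q := by rw [← hq]
  rw [hq, hq']
  rw [hq'] at h2
  rw [agrees_update_iff, agrees_iff r x q]
  have hr := (r q).isLt
  generalize (∀ k : Fin (ν + 2), k ≠ q → x.1 k ≠ 0 → (r k : ℕ) + 1 = x.1 k) = A
  by_cases hA : A <;> simp only [hA, and_true, and_false, false_and]
  split_ifs with h <;> omega

theorem token_le (l : Fin ν × Bool) : token l ≤ 2 * ν + 1 := by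
  unfold token
  have := Bool.toNat_lt l.2
  omega

-- If `x` agrees with `r`, exactly one of `voter` and `next` does: either the present literal is
-- true and its voter takes the single point, or the point passes to the later literals.
open Classical in
theorem agreeing_voters_append {x : Partial} (hx : x.WF ν) (c : List (Fin ν × Bool))
    (acc : List ℕ) :
    agreeing r (voters ν x (c.map token ++ 0 :: acc)) =
      (if Agrees r x ∧ ∃ l ∈ c, LitTrue r l then 1 else 0) +
        agreeing r (voters ν blank acc) := by
  induction c generalizing x with
  | nil =>
    have h : ¬ Agrees r (voter ν x 0) := fun h => h.1 (by simp [voter])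
    simp [voters, agreeing, h, next_of_lt_two hx]
  | cons l c ih =>
    have e : agreeing r (voters ν x ((l :: c).map token ++ 0 :: acc)) =
        (if Agrees r (voter ν x (token l)) then 1 else 0) +
          agreeing r (voters ν (next ν x (token l)) (c.map token ++ 0 :: acc)) := by
      simp [voters, agreeing]
    rw [e, ih (hx.next (token_le l)), agrees_voter_iff r hx, agrees_next_iff r hx]
    by_cases h1 : Agrees r x <;> by_cases h2 : LitTrue r l <;> simp [h1, h2]

theorem pushClause_eq (acc : List ℕ) (c : List (Fin ν × Bool)) :
    pushClause acc c = c.reverse.map token ++ 0 :: acc := by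
  unfold pushClause
  generalize 0 :: acc = a
  induction c generalizing a with
  | nil => rfl
  | cons l c ih => simp [ih]

open Classical in
theorem agreeing_foldl (cs : List (List (Fin ν × Bool))) (acc : List ℕ) :
    agreeing r (voters ν blank (cs.foldl pushClause acc)) =
      cs.countP (fun c => ∃ l ∈ c, LitTrue r l) + agreeing r (voters ν blank acc) := by
  induction cs generalizing acc with
  | nil => simp
  | cons c cs ih =>
    have hb : Agrees r blank := ⟨by simp [blank], by simp [blank]⟩
    rw [List.foldl_cons, ih, pushClause_eq, agreeing_voters_append r (wf_blank ν),
      List.countP_cons]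
    simp only [hb, true_and, List.mem_reverse, decide_eq_true_eq]
    ring

end

/-! ### Correctness of the reduction -/

/-- The voters of the profile for `φ`. -/
def votersOf (φ : SAT.Formula) : List Partial := voters φ.ν blank (tokens φ)

def profile (φ : SAT.Formula) : Profile := profileOf φ.ν (votersOf φ)

def target (φ : SAT.Formula) : ℕ := (tokens φ).length * (φ.ν + 2) - φ.clauses.length

theorem tokens_le (φ : SAT.Formula) : ∀ t ∈ tokens φ, t ≤ 2 * φ.ν + 1 := by
  have : ∀ (cs : List (List (Fin φ.ν × Bool))) (acc : List ℕ), (∀ t ∈ acc, t ≤ 2 * φ.ν + 1) →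
      ∀ t ∈ cs.foldl pushClause acc, t ≤ 2 * φ.ν + 1 := by
    intro cs
    induction cs with
    | nil => exact fun acc h => h
    | cons c cs ih =>
      intro acc h
      refine ih _ fun t ht => ?_
      rw [pushClause_eq] at ht
      simp only [List.mem_append, List.mem_map, List.mem_cons] at ht
      rcases ht with ⟨l, -, rfl⟩ | rfl | ht
      · exact token_le l
      · omega
      · exact h t ht
  exact this _ _ (by simp)

theorem wf_votersOf (φ : SAT.Formula) : ∀ x ∈ votersOf φ, x.WF φ.ν :=
  (wf_blank φ.ν).voters (tokens_le φ)

theorem length_votersOf (φ : SAT.Formula) : (votersOf φ).length = (tokens φ).length :=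
  length_voters _ _ _

theorem length_foldl_pushClause {ν : ℕ} (cs : List (List (Fin ν × Bool))) (acc : List ℕ) :
    (cs.foldl pushClause acc).length = acc.length + (cs.map fun c => c.length + 1).sum := by
  induction cs generalizing acc with
  | nil => simp
  | cons c cs ih =>
    rw [List.foldl_cons, ih, pushClause_eq]
    simp
    ring

theorem length_tokens (φ : SAT.Formula) :
    (tokens φ).length = 1 + (φ.clauses.map fun c => c.length + 1).sum :=
  length_foldl_pushClause _ _

theorem length_clauses_le (φ : SAT.Formula) : φ.clauses.length ≤ (tokens φ).length := by
  rw [length_tokens]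
  have : ∀ cs : List (List (Fin φ.ν × Bool)),
      cs.length ≤ (cs.map fun c => c.length + 1).sum := by
    intro cs
    induction cs with
    | nil => simp
    | cons c cs ih => simp; omega
  have := this φ.clauses
  omega

theorem agreeing_votersOf (φ : SAT.Formula) (r : Fin (φ.ν + 2) → Fin 2) :
    φ.clauses.length ≤ agreeing r (votersOf φ) ↔ ∀ c ∈ φ.clauses, ∃ l ∈ c, LitTrue r l := by
  classical
  unfold votersOf tokens
  rw [agreeing_foldl]
  have h : ¬ Agrees r (voter φ.ν blank 0) := fun h => h.1 (by simp [voter])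
  have : agreeing r (voters φ.ν blank [0]) = 0 := by simp [voters, agreeing, h]
  rw [this, add_zero]
  constructor
  · intro h
    simpa using List.countP_eq_length.1 (le_antisymm List.countP_le_length h)
  · intro h
    exact (List.countP_eq_length.2 (by simpa using h)).ge

theorem cost_le_target_iff (φ : SAT.Formula) (r : Fin (φ.ν + 2) → Fin 2) :
    (profile φ).cost r ≤ target φ ↔ ∀ c ∈ φ.clauses, ∃ l ∈ c, LitTrue r l := by
  rw [← agreeing_votersOf]
  have h := cost_profileOf (wf_votersOf φ) r
  rw [length_votersOf] at h
  -- The truncated subtraction in `target` is a true one, since there are at least as many voters as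
  -- clauses.
  have h1 := length_clauses_le φ
  have h2 : (tokens φ).length ≤ (tokens φ).length * (φ.ν + 2) :=
    Nat.le_mul_of_pos_right _ (by omega)
  unfold profile target
  omega

theorem satisfiable_iff (φ : SAT.Formula) :
    φ.Satisfiable ↔ ∃ r : Fin (φ.ν + 2) → Fin 2, (profile φ).cost r ≤ target φ := by
  simp only [cost_le_target_iff]
  constructor
  · rintro ⟨α, hα⟩
    -- Variable `v` is issue `v + 1`; the values at issues `0` and `φ.ν + 1` are arbitrary.
    refine ⟨fun k => if h : 1 ≤ (k : ℕ) ∧ (k : ℕ) ≤ φ.ν then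
      if α ⟨k - 1, by omega⟩ then 1 else 0 else 0, fun c hc => ?_⟩
    obtain ⟨⟨v, b⟩, hl, hv⟩ := hα c hc
    refine ⟨_, hl, ?_⟩
    simp only at hv
    unfold LitTrue
    simp only [Nat.le_add_left, true_and, Nat.add_sub_cancel]
    rw [dif_pos (by omega), hv]
    cases b <;> rfl
  · rintro ⟨r, hr⟩
    refine ⟨fun v => decide ((r ⟨v + 1, by omega⟩ : ℕ) = 1), fun c hc => ?_⟩
    obtain ⟨⟨v, b⟩, hl, hv⟩ := hr c hc
    refine ⟨_, hl, ?_⟩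
    unfold LitTrue at hv
    simp only at hv ⊢
    rw [hv]
    cases b <;> rfl

/-- The voter of any terminator joins issue `0` to all other issues. -/
theorem noIsolatedIssue_profile (φ : SAT.Formula) : (profile φ).NoIsolatedIssue := by
  have hmem : ∃ T : ℕ → ℕ, (∀ k, 1 ≤ k → k ≤ φ.ν + 1 → T k = 1) ∧ (T, 0) ∈ votersOf φ := by
    have : ∀ (x : Partial) (l : List ℕ), 0 ∈ l →
        ∃ T : ℕ → ℕ, (∀ k, 1 ≤ k → k ≤ φ.ν + 1 → T k = 1) ∧ (T, 0) ∈ voters φ.ν x l := by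
      intro x l
      induction l generalizing x with
      | nil => simp
      | cons t l ih =>
        intro h
        rcases List.mem_cons.1 h with rfl | h
        · exact ⟨(voter φ.ν x 0).1, fun k h1 h2 => by simp [voter, h1, h2], by
            simp [voters, voter]⟩
        · obtain ⟨T, hT, h⟩ := ih (next φ.ν x t) h
          exact ⟨T, hT, by simp [voters, h]⟩
    refine this _ _ ?_
    have : ∀ (cs : List (List (Fin φ.ν × Bool))) (acc : List ℕ), 0 ∈ acc →
        0 ∈ cs.foldl pushClause acc := by
      intro cs
      induction cs with
      | nil => exact fun acc h => h
      | cons c cs ih => exact fun acc h => ih _ (by rw [pushClause_eq]; simp)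
    exact this _ _ (by simp)
  obtain ⟨T, hT, hmem⟩ := hmem
  obtain ⟨i, hi, hiT⟩ := List.getElem_of_mem hmem
  have key : ∀ k : Fin (φ.ν + 2), k ≠ 0 → k ∈ (ballotOf φ.ν (votersOf φ)[i]).inNbr 0 := by
    intro k hk
    rw [hiT]
    have hk' : (k : ℕ) ≠ 0 := fun h => hk (Fin.ext h)
    simp [ballotOf, hk, hT k (by omega) (by omega)]
  have adj : ∀ k : Fin (φ.ν + 2), k ≠ 0 → (profile φ).globalGraph.Adj k (0 : Fin (φ.ν + 2)) := fun k hk =>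
    (SimpleGraph.fromRel_adj _ _ _).2 ⟨hk, Or.inl ⟨⟨i, hi⟩, key k hk⟩⟩
  intro j
  change Fin (φ.ν + 2) at j
  by_cases hj : j = (0 : Fin (φ.ν + 2))
  · rw [hj]
    exact ⟨(1 : Fin (φ.ν + 2)), (adj 1 (by simp)).symm⟩
  · exact ⟨(0 : Fin (φ.ν + 2)), adj j hj⟩

theorem d_profile (φ : SAT.Formula) : (profile φ).d = 2 :=
  Finset.sup_const (Finset.univ_nonempty (α := Fin (φ.ν + 2))) 2

/-! ## A program for the reduction -/

open RAM RAM.Prog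

/-! ### Memory layouts -/

/-- The memory whose nonzero cells are those of the word `l`, written from address `p` on. -/
def tape (p : ℕ) (l : List ℕ) : ℕ → ℕ := fun a => if a < p then 0 else l.getD (a - p) 0

theorem tape_self (p x : ℕ) (l : List ℕ) : tape p (x :: l) p = x := by simp [tape]

theorem tape_nil (p : ℕ) : tape p [] = fun _ => 0 := by ext; simp [tape]

/-- Input cells are erased as they are read, so the output finds a blank memory. -/
theorem update_tape (p x : ℕ) (l : List ℕ) :
    Function.update (tape p (x :: l)) p 0 = tape (p + 1) l := by
  ext a
  rcases lt_trichotomy a p with h | h | h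
  · simp [tape, h.ne, h, Nat.lt_succ_of_lt h]
  · subst h; simp [tape]
  · obtain ⟨d, rfl⟩ : ∃ d, a = p + 1 + d := ⟨a - (p + 1), by omega⟩
    rw [Function.update_of_ne (by omega)]
    simp only [tape, show ¬ p + 1 + d < p by omega, show ¬ p + 1 + d < p + 1 by omega, if_false]
    rw [show p + 1 + d - p = d + 1 by omega, show p + 1 + d - (p + 1) = d by omega]
    simp

/-- The memory with the word `out` from address `0` on and the table `T` from address `F` on. -/
def mem (out : List ℕ) (F : ℕ) (T : ℕ → ℕ) : ℕ → ℕ :=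
  fun a => if a < out.length then out.getD a 0 else if F ≤ a then T (a - F) else 0

theorem mem_table {out : List ℕ} {F : ℕ} (T : ℕ → ℕ) (k : ℕ) (h : out.length ≤ F) :
    mem out F T (F + k) = T k := by
  simp only [mem]
  rw [if_neg (by omega), if_pos (by omega), Nat.add_sub_cancel_left]

theorem update_mem_table {out : List ℕ} {F : ℕ} (T : ℕ → ℕ) (k x : ℕ) (h : out.length ≤ F) :
    Function.update (mem out F T) (F + k) x = mem out F (Function.update T k x) := by
  ext a
  by_cases ha : a = F + k
  · subst ha
    rw [Function.update_self, mem_table _ _ h, Function.update_self]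
  · rw [Function.update_of_ne ha]
    simp only [mem]
    split_ifs with h1 h2
    · rfl
    · rw [Function.update_of_ne (by omega)]
    · rfl

theorem update_mem_end {out : List ℕ} {F p : ℕ} (T : ℕ → ℕ) (x : ℕ) (h : p = out.length)
    (h' : p < F) : Function.update (mem out F T) p x = mem (out ++ [x]) F T := by
  subst h
  ext a
  by_cases ha : a = out.length
  · subst ha
    simp [mem]
  · rw [Function.update_of_ne ha]
    simp only [mem, List.length_append, List.length_singleton]
    by_cases h1 : a < out.length
    · rw [if_pos h1, if_pos (by omega), List.getD_append _ _ _ _ h1]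
    · rw [if_neg h1, if_neg (by omega : ¬ a < out.length + 1)]

/-- Zeros of the output need not be written: advancing the address suffices. -/
theorem mem_append_zeros {out : List ℕ} {F k : ℕ} (T : ℕ → ℕ) (h : out.length + k ≤ F) :
    mem (out ++ List.replicate k 0) F T = mem out F T := by
  ext a
  simp only [mem, List.length_append, List.length_replicate]
  by_cases h1 : a < out.length
  · rw [if_pos h1, if_pos (by omega), List.getD_append _ _ _ _ h1]
  · rw [if_neg h1]
    by_cases h2 : a < out.length + k
    · rw [if_pos h2, if_neg (by omega), List.getD_append_right _ _ _ _ (by omega)]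
      simp
    · rw [if_neg h2]

/-! ### Token lists packed into one number -/

/-- A list of numbers below `B` as the digits of a number. -/
def pack (B : ℕ) : List ℕ → ℕ
  | [] => 0
  | t :: l => pack B l * B + t

theorem pack_lt_pow {B : ℕ} {l : List ℕ} (h : ∀ t ∈ l, t < B) : pack B l < B ^ l.length := by
  induction l with
  | nil => simp [pack]
  | cons t l ih =>
    have h1 := ih fun t' h' => h t' (by simp [h'])
    have h2 := h t (by simp)
    have h3 : (pack B l + 1) * B ≤ B ^ l.length * B := Nat.mul_le_mul_right _ h1
    simp only [pack, List.length_cons, pow_succ]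
    rw [add_mul] at h3
    omega

/-- Pushing never decreases the packed number, so a bound on the final one covers all intermediate
ones. -/
theorem le_pack_cons {B : ℕ} (hB : 0 < B) (t : ℕ) (l : List ℕ) : pack B l ≤ pack B (t :: l) := by
  have := Nat.le_mul_of_pos_right (pack B l) hB
  simp only [pack]
  omega

theorem le_pack_append {B : ℕ} (hB : 0 < B) (l l' : List ℕ) : pack B l' ≤ pack B (l ++ l') := by
  induction l with
  | nil => exact le_rfl
  | cons t l ih => exact ih.trans (le_pack_cons hB _ _)

theorem le_pack_foldl {B ν : ℕ} (hB : 0 < B) (cs : List (List (Fin ν × Bool))) (acc : List ℕ) :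
    pack B acc ≤ pack B (cs.foldl pushClause acc) := by
  induction cs generalizing acc with
  | nil => exact le_rfl
  | cons c cs ih =>
    refine le_trans ?_ (ih _)
    rw [pushClause_eq]
    exact (le_pack_cons hB _ _).trans (le_pack_append hB _ _)

/-! The registers are `0`: the constant one; `1`: the current address of input or output;
`2`: the number of issues; `3`: a counter of clauses or tokens; `4`: the packed tokens;
`5`: their base; `6`: the number of tokens; `7`: a counter of literals, or the flag;
`10`: the number of clauses, or the number of zeros at the end of a ballot; `11`: the address of
the table; `12`, `13`: the token; `14`, `16`: counter and address for passes over the table;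
`15`: the approval bit; `8`, `9`: auxiliary; `17`: the constant zero. -/

/-! ### Reading the formula -/

def readLiteral : List Prog :=
  -- Register `17` lies outside the list of registers and reads as `0`, so `store 1 17` erases the
  -- current cell.
  [load 8 1, store 1 17, add 1 1 0, load 9 1, store 1 17, add 1 1 0, add 8 8 8, add 8 8 9,
    add 8 8 0, add 8 8 0, mul 4 4 5, add 4 4 8, add 6 6 0, sub 7 7 0, const 8 0, const 9 0]

def readClauseHead : List Prog :=
  [mul 4 4 5, add 6 6 0, load 7 1, store 1 17, add 1 1 0]

def readHead : List Prog :=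
  [const 0 1, load 2 1, store 1 17, add 1 1 0, load 3 1, store 1 17, add 1 1 0, copy 10 3,
    -- The packed form of the initial list `[0]` is `0`. Leading zero digits are invisible, so the
    -- number of tokens is counted separately and starts at `1`.
    const 6 1, add 5 2 2, const 8 4, add 5 5 8, const 8 0]

def readFormula : Prog :=
  seq (block readHead) (loop 3 (seq (block readClauseHead)
    (seq (loop 7 (block readLiteral)) (block [sub 3 3 0]))))

def encodeLits {ν : ℕ} (c : List (Fin ν × Bool)) : List ℕ :=
  c.flatMap fun l => [(l.1 : ℕ), l.2.toNat]

def encodeClauses {ν : ℕ} (cs : List (List (Fin ν × Bool))) : List ℕ :=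
  cs.flatMap fun c => c.length :: encodeLits c

theorem run_readLiterals {V ν p c n s : ℕ} (d : List (Fin ν × Bool)) (acc rest : List ℕ)
    (hν : 2 * ν + 4 ≤ V) (hp : p + 2 * d.length ≤ V) (hn : n + d.length ≤ V)
    (hX : pack (2 * ν + 4) (d.foldl (fun a l => token l :: a) acc) ≤ V) :
    Run V (18 * d.length + 1) (loop 7 (block readLiteral))
      ([1, p, ν, c, pack (2 * ν + 4) acc, 2 * ν + 4, n, d.length, 0, 0, s, 0, 0, 0, 0, 0, 0],
        tape p (encodeLits d ++ rest))
      ([1, p + 2 * d.length, ν, c, pack (2 * ν + 4) (d.foldl (fun a l => token l :: a) acc),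
        2 * ν + 4, n + d.length, 0, 0, 0, s, 0, 0, 0, 0, 0, 0],
        tape (p + 2 * d.length) rest) := by
  induction d generalizing p n acc with
  | nil => exact Run.loop_false rfl
  | cons l d ih =>
    have hle : ∀ (d : List (Fin ν × Bool)) acc, pack (2 * ν + 4) acc ≤
        pack (2 * ν + 4) (d.foldl (fun a l => token l :: a) acc) := by
      intro d
      induction d with
      | nil => exact fun _ => le_rfl
      | cons l d ih => exact fun acc => (le_pack_cons (by omega) _ _).trans (ih _)
    have h1 := (hle d (token l :: acc)).trans hX
    have h2 := (le_pack_cons (B := 2 * ν + 4) (by omega) (token l) acc).trans h1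
    simp only [List.length_cons] at hp hn
    have hl := l.1.isLt
    have hb := Bool.toNat_lt l.2
    have h := ih (p := p + 2) (n := n + 1) (token l :: acc) (by omega) (by omega) hX
    rw [show p + 2 + 2 * d.length = p + 2 * (d.length + 1) by ring,
      show n + 1 + d.length = n + (d.length + 1) by ring] at h
    refine (Run.loop_true (n := 17) (by simp) (by simp; omega) (Run.block ?_ ?_) h).mono
      (by simp only [List.length_cons]; omega)
    · simp only [pack, token] at h1
      simp [readLiteral, OkAll, Ok, step, encodeLits, tape_self, update_tape]
      omega
    · simp [readLiteral, steps, step, encodeLits, tape_self, update_tape, pack, token]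
      omega

theorem length_encodeLits {ν : ℕ} (c : List (Fin ν × Bool)) :
    (encodeLits c).length = 2 * c.length := by
  simp [encodeLits, List.length_flatMap]; ring

theorem length_encodeClauses_cons {ν : ℕ} (c : List (Fin ν × Bool))
    (cs : List (List (Fin ν × Bool))) :
    (encodeClauses (c :: cs)).length = 1 + 2 * c.length + (encodeClauses cs).length := by
  rw [← length_encodeLits]; simp [encodeClauses]; ring

theorem length_tokens_lt (φ : SAT.Formula) : (tokens φ).length < φ.encode.length := by
  have h : ∀ cs : List (List (Fin φ.ν × Bool)),
      (cs.map fun c => c.length + 1).sum ≤ (encodeClauses cs).length := by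
    intro cs
    induction cs with
    | nil => simp
    | cons c cs ih =>
      rw [length_encodeClauses_cons, List.map_cons, List.sum_cons]
      omega
  have h := h φ.clauses
  have hL : φ.encode.length = 2 + (encodeClauses φ.clauses).length := by
    rw [show φ.encode = φ.ν :: φ.clauses.length :: encodeClauses φ.clauses from rfl]
    simp; omega
  rw [length_tokens]
  omega

theorem length_pushClause {ν : ℕ} (acc : List ℕ) (c : List (Fin ν × Bool)) :
    (pushClause acc c).length = acc.length + c.length + 1 := by
  rw [pushClause_eq]; simp; ring

theorem run_readClauses {V ν p s : ℕ} (cs : List (List (Fin ν × Bool))) (acc : List ℕ)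
    (hν : 2 * ν + 4 ≤ V) (hp : p + (encodeClauses cs).length ≤ V)
    (hn : (cs.foldl pushClause acc).length ≤ V)
    (hX : pack (2 * ν + 4) (cs.foldl pushClause acc) ≤ V) :
    Run V (18 * (encodeClauses cs).length + 1)
      (loop 3 (seq (block readClauseHead) (seq (loop 7 (block readLiteral)) (block [sub 3 3 0]))))
      ([1, p, ν, cs.length, pack (2 * ν + 4) acc, 2 * ν + 4, acc.length, 0, 0, 0, s, 0, 0, 0, 0,
        0, 0], tape p (encodeClauses cs))
      ([1, p + (encodeClauses cs).length, ν, 0, pack (2 * ν + 4) (cs.foldl pushClause acc),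
        2 * ν + 4, (cs.foldl pushClause acc).length, 0, 0, 0, s, 0, 0, 0, 0, 0, 0],
        fun _ => 0) := by
  induction cs generalizing p acc with
  | nil =>
    rw [show (fun _ => 0 : ℕ → ℕ) = tape p (encodeClauses ([] : List (List (Fin ν × Bool)))) from
      (tape_nil p).symm]
    exact Run.loop_false rfl
  | cons c cs ih =>
    have hlen := length_encodeClauses_cons c cs
    have hcs : cs.length ≤ (encodeClauses cs).length := by
      clear * -
      induction cs with
      | nil => simp
      | cons c cs ih => rw [length_encodeClauses_cons]; simp; omega
    rw [hlen] at hp ⊢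
    have h1 := (le_pack_foldl (B := 2 * ν + 4) (by omega) cs (pushClause acc c)).trans hX
    have h2 : pack (2 * ν + 4) (0 :: acc) ≤ V := by
      refine le_trans ?_ h1
      rw [pushClause_eq]
      exact le_pack_append (by omega) _ _
    have h3 := (le_pack_cons (B := 2 * ν + 4) (by omega) 0 acc).trans h2
    have h4 : (pushClause acc c).length ≤ V := by
      refine le_trans ?_ hn
      rw [List.foldl_cons, length_foldl_pushClause]
      omega
    rw [length_pushClause] at h4
    have h := ih (p := p + 1 + 2 * c.length) (pushClause acc c) (by omega) hn hX
    rw [show p + 1 + 2 * c.length + (encodeClauses cs).length =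
      p + (1 + 2 * c.length + (encodeClauses cs).length) by ring] at h
    have hm := run_readLiterals (V := V) (p := p + 1) (c := cs.length + 1) (n := acc.length + 1)
      (s := s) c (0 :: acc) (encodeClauses cs) hν (by omega) (by omega) h1
    have e : encodeClauses (c :: cs) = c.length :: (encodeLits c ++ encodeClauses cs) := by
      simp [encodeClauses]
    rw [e, List.length_cons]
    have hh : Run V 6 (block readClauseHead)
        ([1, p, ν, cs.length + 1, pack (2 * ν + 4) acc, 2 * ν + 4, acc.length, 0, 0, 0, s, 0, 0, 0,
          0, 0, 0], tape p (c.length :: (encodeLits c ++ encodeClauses cs)))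
        ([1, p + 1, ν, cs.length + 1, pack (2 * ν + 4) (0 :: acc), 2 * ν + 4, acc.length + 1,
          c.length, 0, 0, s, 0, 0, 0, 0, 0, 0],
          tape (p + 1) (encodeLits c ++ encodeClauses cs)) := by
      refine Run.block ?_ ?_
      · simp only [pack] at h2
        simp [readClauseHead, OkAll, Ok, step, tape_self, update_tape]
        omega
      · simp [readClauseHead, steps, step, tape_self, update_tape, pack]
    have ht : Run V 2 (block [sub 3 3 0])
        ([1, p + 1 + 2 * c.length, ν, cs.length + 1, pack (2 * ν + 4) (pushClause acc c),
          2 * ν + 4, acc.length + 1 + c.length, 0, 0, 0, s, 0, 0, 0, 0, 0, 0],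
          tape (p + 1 + 2 * c.length) (encodeClauses cs))
        ([1, p + 1 + 2 * c.length, ν, cs.length, pack (2 * ν + 4) (pushClause acc c),
          2 * ν + 4, (pushClause acc c).length, 0, 0, 0, s, 0, 0, 0, 0, 0, 0],
          tape (p + 1 + 2 * c.length) (encodeClauses cs)) := by
      refine Run.block ?_ ?_
      · simp [OkAll, Ok]
        omega
      · simp [steps, step, length_pushClause]
        omega
    exact (Run.loop_true (by simp) (by simp; omega) (hh.seq (hm.seq ht)) h).mono (by omega)

theorem run_readFormula {V : ℕ} (φ : SAT.Formula) (hν : 2 * φ.ν + 4 ≤ V)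
    (hL : φ.encode.length ≤ V) (hX : pack (2 * φ.ν + 4) (tokens φ) ≤ V) :
    Run V (18 * φ.encode.length) readFormula
      (List.replicate 17 0, tape 0 φ.encode)
      ([1, φ.encode.length, φ.ν, 0, pack (2 * φ.ν + 4) (tokens φ), 2 * φ.ν + 4,
        (tokens φ).length, 0, 0, 0, φ.clauses.length, 0, 0, 0, 0, 0, 0], fun _ => 0) := by
  have e : φ.encode = φ.ν :: φ.clauses.length :: encodeClauses φ.clauses := rfl
  have hL' : φ.encode.length = 2 + (encodeClauses φ.clauses).length := by
    rw [e]; simp; omega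
  have hc := length_clauses_le φ
  have hn : (tokens φ).length + 1 ≤ φ.encode.length := length_tokens_lt φ
  have hh : Run V 14 (block readHead)
      (List.replicate 17 0, tape 0 φ.encode)
      ([1, 2, φ.ν, φ.clauses.length, pack (2 * φ.ν + 4) [0], 2 * φ.ν + 4, [0].length, 0, 0, 0,
        φ.clauses.length, 0, 0, 0, 0, 0, 0], tape 2 (encodeClauses φ.clauses)) := by
    rw [e]
    have h1 := fun x l => tape_self 0 x l
    have h2 := fun x l => update_tape 0 x l
    have h3 := fun x l => tape_self 1 x l
    have h4 := fun x l => update_tape 1 x l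
    refine Run.block ?_ ?_
    · simp [readHead, OkAll, Ok, step, h1, h2, h3]
      omega
    · simp [readHead, steps, step, h1, h2, h3, h4, pack]
      omega
  have h := run_readClauses (V := V) (p := 2) (s := φ.clauses.length) φ.clauses [0] hν
    (by omega) (by change (tokens φ).length ≤ V; omega) hX
  rw [hL']
  exact (hh.seq h).mono (by omega)

/-! ### Writing the profile -/

def emitDomain : List Prog := [store 1 8, add 1 1 0, add 1 1 0, store 1 0, add 1 1 0, sub 14 14 0]

/-- The length of the whole output is computed beforehand, to place the table of the current partial
assignment just beyond it. -/
def emitHead : List Prog :=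
  [const 8 2, add 2 2 8, mul 8 6 2, sub 10 8 10, add 8 2 0, mul 8 8 8, add 8 8 0, mul 8 8 6,
    add 11 2 2, add 11 11 2, add 11 11 8, const 8 3, add 11 11 8, const 1 0, store 1 2, add 1 1 0,
    store 1 6, add 1 1 0, store 1 10, add 1 1 0, copy 14 2, const 8 2]

def prepareVoters : List Prog :=
  [sub 8 2 0, add 9 2 0, mul 10 8 9, copy 3 6, const 7 1, const 8 0, const 9 0]

def popToken : List Prog :=
  [div 8 4 5, mul 9 8 5, sub 13 4 9, copy 4 8, const 8 2, div 12 13 8, add 8 12 12, sub 13 13 8,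
    const 8 0, const 9 0]

/-- Equality is tested without branching: if `D` is the sum of the two truncated differences, then
`D - (D - 1)` is `0` for equal numbers and `1` otherwise. The flag is multiplied by it. -/
def setLiteral : List Prog :=
  [add 16 11 12, load 8 16, const 9 2, sub 9 9 13, sub 15 8 9, sub 9 9 8, add 15 15 9, sub 9 15 0,
    sub 15 15 9, mul 15 7 15, add 13 13 0, store 16 13, sub 9 8 13, sub 8 13 8, add 9 9 8,
    sub 8 9 0, sub 9 9 8, mul 7 7 9, const 8 3, sub 13 8 13, const 8 0, const 9 0]

def fillStep : List Prog := [store 16 9, add 16 16 0, sub 14 14 0]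

def fill (x : ℕ) : Prog :=
  seq (block [const 9 x, add 16 11 0, sub 14 2 0])
    (seq (loop 14 (block fillStep)) (block [const 9 0]))

def nbrStep : List Prog :=
  -- The indicator `min u 1` of a table entry `u` is computed as `u - (u - 1)`.
  [load 8 16, sub 9 8 0, sub 8 8 9, store 1 8, add 1 1 0, add 16 16 0, sub 14 14 0, const 8 0,
    const 9 0]

def premiseStep : List Prog :=
  [load 8 16, sub 8 8 0, store 1 8, add 1 1 0, add 16 16 0, sub 14 14 0, const 8 0]

def emitVoter : Prog :=
  seq (block [copy 14 2, copy 16 11]) (seq (loop 14 (block nbrStep))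
    (seq (block [store 1 0, add 1 1 0, copy 14 2, copy 16 11]) (seq (loop 14 (block premiseStep))
      -- The last instruction skips the zeros that encode the other issues.
      (block [store 1 15, add 1 1 0, store 1 15, add 1 1 0, add 1 1 10]))))

/-- The table is brought to the state of `voter`, written out, and turned into that of `next`. For a
literal the two differ in one cell only. -/
def emitToken : Prog :=
  seq (block popToken)
    (seq (ite 12 (block setLiteral) (seq (fill 1) (block [const 15 0])))
      (seq emitVoter
        (seq (ite 12 (block [add 16 11 12, store 16 13]) (seq (fill 0) (block [const 7 1])))
          (block [const 12 0, const 13 0, const 15 0, const 16 0, sub 3 3 0]))))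

/-- The final block clears the registers, because the program that follows expects a start state. -/
def reduction : Prog :=
  seq readFormula (seq (block emitHead) (seq (loop 14 (block emitDomain))
    (seq (block prepareVoters) (seq (loop 3 emitToken)
      (block [const 0 0, const 1 0, const 2 0, const 5 0, const 6 0, const 7 0, const 10 0,
        const 11 0])))))

section
variable {V ν F : ℕ}

theorem run_emitDomain {n s : ℕ} {B X : ℕ} (k : ℕ) (out : List ℕ) (T : ℕ → ℕ)
    (hF : out.length + 3 * k ≤ F) (hV : F ≤ V) (h2 : 2 ≤ V) :
    Run V (8 * k + 1) (loop 14 (block emitDomain))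
      ([1, out.length, ν, 0, X, B, n, 0, 2, 0, s, F, 0, 0, k, 0, 0], mem out F T)
      ([1, out.length + 3 * k, ν, 0, X, B, n, 0, 2, 0, s, F, 0, 0, 0, 0, 0],
        mem (out ++ (List.replicate k [2, 0, 1]).flatten) F T) := by
  induction k generalizing out with
  | zero => simpa using Run.loop_false rfl
  | succ k ih =>
    have h := ih (out ++ [2, 0, 1]) (by simp; omega)
    have e1 : (out ++ [2, 0, 1]).length + 3 * k = out.length + 3 * (k + 1) := by simp; ring
    have e2 : out ++ [2, 0, 1] ++ (List.replicate k [2, 0, 1]).flatten =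
        out ++ (List.replicate (k + 1) [2, 0, 1]).flatten := by simp [List.replicate_succ]
    rw [e1, e2] at h
    have hz : mem (out ++ [2]) F T = mem (out ++ [2, 0]) F T := by
      have := mem_append_zeros (out := out ++ [2]) (k := 1) (F := F) T (by simp; omega)
      simpa using this.symm
    refine (Run.loop_true (n := 7) (by simp) (by simp; omega) (Run.block ?_ ?_) h).mono (by omega)
    · simp [OkAll, Ok, emitDomain, step]
      omega
    · have h1 := update_mem_end (out := out) (F := F) T 2 rfl (by omega)
      have h2 := update_mem_end (out := out ++ [2, 0]) (F := F) (p := out.length + 1 + 1) T 1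
        (by simp) (by omega)
      simp [steps, emitDomain, step, h1, hz, h2]

/-- `T` with the value `x` at `j, …, j + k - 1`. -/
def setRange (T : ℕ → ℕ) (x j k : ℕ) : ℕ → ℕ := fun i => if j ≤ i ∧ i < j + k then x else T i

theorem run_fillLoop {p c X B n a s q b e x : ℕ} (k j : ℕ) {out : List ℕ} (T : ℕ → ℕ)
    (hF : out.length ≤ F) (hV : F + j + k ≤ V) (h2 : 1 ≤ V) (hx : x ≤ V) :
    Run V (5 * k + 1) (loop 14 (block fillStep))
      ([1, p, ν, c, X, B, n, a, 0, x, s, F, q, b, k, e, F + j], mem out F T)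
      ([1, p, ν, c, X, B, n, a, 0, x, s, F, q, b, 0, e, F + j + k],
        mem out F (setRange T x j k)) := by
  induction k generalizing T j with
  | zero =>
    have : setRange T x j 0 = T := by
      funext i
      simp only [setRange]
      rw [if_neg (by omega)]
    rw [this]
    exact Run.loop_false rfl
  | succ k ih =>
    have h := ih (j + 1) (Function.update T j x) (by omega)
    have e1 : setRange (Function.update T j x) x (j + 1) k = setRange T x j (k + 1) := by
      funext i
      simp only [setRange]
      by_cases hi : i = j
      · subst hi
        rw [if_neg (by omega), if_pos (by omega), Function.update_self]
      · rw [Function.update_of_ne hi]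
        congr 1
        apply propext
        omega
    rw [e1, ← add_assoc F, show F + j + 1 + k = F + j + (k + 1) by ring] at h
    refine (Run.loop_true (n := 4) (by simp) (by simp; omega) (Run.block ?_ ?_) h).mono (by omega)
    · simp [OkAll, Ok, fillStep, step]
      omega
    · simp [steps, fillStep, step, update_mem_table _ _ _ hF]

theorem run_fill {p c X B n a s q b e x f : ℕ} {out : List ℕ} (T : ℕ → ℕ)
    (hF : out.length ≤ F) (hV : F + ν + 2 ≤ V) (hx : x ≤ V) :
    Run V (5 * ν + 13) (fill x)
      ([1, p, ν + 2, c, X, B, n, a, 0, 0, s, F, q, b, 0, e, f], mem out F T)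
      ([1, p, ν + 2, c, X, B, n, a, 0, 0, s, F, q, b, 0, e, F + 1 + (ν + 1)],
        mem out F (setRange T x 1 (ν + 1))) := by
  have h1 : Run V 4 (block [const 9 x, add 16 11 0, sub 14 2 0])
      ([1, p, ν + 2, c, X, B, n, a, 0, 0, s, F, q, b, 0, e, f], mem out F T)
      ([1, p, ν + 2, c, X, B, n, a, 0, x, s, F, q, b, ν + 1, e, F + 1], mem out F T) := by
    refine Run.block ?_ ?_
    · simp [OkAll, Ok, step]
      omega
    · simp [steps, step]
  have h2 := run_fillLoop (V := V) (ν := ν + 2) (p := p) (c := c) (X := X) (B := B) (n := n)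
    (a := a) (s := s) (q := q) (b := b) (e := e) (x := x) (ν + 1) 1 T hF (by omega) (by omega) hx
  have h3 : Run V 2 (block [const 9 0])
      ([1, p, ν + 2, c, X, B, n, a, 0, x, s, F, q, b, 0, e, F + 1 + (ν + 1)],
        mem out F (setRange T x 1 (ν + 1)))
      ([1, p, ν + 2, c, X, B, n, a, 0, 0, s, F, q, b, 0, e, F + 1 + (ν + 1)],
        mem out F (setRange T x 1 (ν + 1))) := by
    refine Run.block ?_ ?_
    · simp [OkAll, Ok]
    · simp [steps, step]
  exact (h1.seq (h2.seq h3)).mono (by omega)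

theorem run_nbrLoop {c X B n a s q b e : ℕ} (k j : ℕ) (out : List ℕ) (T : ℕ → ℕ)
    (hF : out.length + k ≤ F) (hV : F + j + k ≤ V) (h1 : 1 ≤ V) (hT : ∀ i, T i ≤ V) :
    Run V (11 * k + 1) (loop 14 (block nbrStep))
      ([1, out.length, ν, c, X, B, n, a, 0, 0, s, F, q, b, k, e, F + j], mem out F T)
      ([1, out.length + k, ν, c, X, B, n, a, 0, 0, s, F, q, b, 0, e, F + j + k],
        mem (out ++ (List.range' j k).map fun i => min (T i) 1) F T) := by
  induction k generalizing out j with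
  | zero => simpa using Run.loop_false rfl
  | succ k ih =>
    have h := ih (j + 1) (out ++ [min (T j) 1]) (by simp; omega) (by omega)
    rw [← add_assoc F, show F + j + 1 + k = F + j + (k + 1) by ring, List.append_assoc,
      List.length_append, List.length_singleton, add_assoc out.length, add_comm 1 k] at h
    have hj := hT j
    have e0 : T j - (T j - 1) = min (T j) 1 := by omega
    refine (Run.loop_true (n := 10) (by simp) (by simp; omega) (Run.block ?_ ?_) h).mono
      (by omega)
    · simp [OkAll, Ok, nbrStep, step, mem_table T j (show out.length ≤ F by omega)]
      omega
    · simp [steps, nbrStep, step, mem_table T j (show out.length ≤ F by omega), e0,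
        update_mem_end T (min (T j) 1) (rfl : out.length = out.length) (show _ < F by omega)]

theorem run_premiseLoop {c X B n a s q b e : ℕ} (k j : ℕ) (out : List ℕ) (T : ℕ → ℕ)
    (hF : out.length + k ≤ F) (hV : F + j + k ≤ V) (h1 : 1 ≤ V) (hT : ∀ i, T i ≤ V) :
    Run V (9 * k + 1) (loop 14 (block premiseStep))
      ([1, out.length, ν, c, X, B, n, a, 0, 0, s, F, q, b, k, e, F + j], mem out F T)
      ([1, out.length + k, ν, c, X, B, n, a, 0, 0, s, F, q, b, 0, e, F + j + k],
        mem (out ++ (List.range' j k).map fun i => T i - 1) F T) := by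
  induction k generalizing out j with
  | zero => simpa using Run.loop_false rfl
  | succ k ih =>
    have h := ih (j + 1) (out ++ [T j - 1]) (by simp; omega) (by omega)
    rw [← add_assoc F, show F + j + 1 + k = F + j + (k + 1) by ring, List.append_assoc,
      List.length_append, List.length_singleton, add_assoc out.length, add_comm 1 k] at h
    have hj := hT j
    refine (Run.loop_true (n := 8) (by simp) (by simp; omega) (Run.block ?_ ?_) h).mono
      (by omega)
    · simp [OkAll, Ok, premiseStep, step, mem_table T j (show out.length ≤ F by omega)]
      omega
    · simp [steps, premiseStep, step, mem_table T j (show out.length ≤ F by omega),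
        update_mem_end T (T j - 1) (rfl : out.length = out.length) (show _ < F by omega)]

theorem run_emitVoter {c X B n a q b f : ℕ} (out : List ℕ) (x : Partial)
    (hF : out.length + (2 * (ν + 2) + 3 + (ν + 1) * (ν + 3)) ≤ F) (hV : F + ν + 2 ≤ V)
    (hT : ∀ i, x.1 i ≤ V) (he : x.2 ≤ V) :
    Run V (20 * ν + 60) emitVoter
      ([1, out.length, ν + 2, c, X, B, n, a, 0, 0, (ν + 1) * (ν + 3), F, q, b, 0, x.2, f],
        mem out F x.1)
      ([1, (out ++ blockOf ν x).length, ν + 2, c, X, B, n, a, 0, 0, (ν + 1) * (ν + 3), F, q, b, 0,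
        x.2, F + (ν + 2)], mem (out ++ blockOf ν x) F x.1) := by
  obtain ⟨T, e⟩ := x
  simp only at hT he ⊢
  obtain ⟨out1, hout1⟩ : ∃ o, o = out ++ (List.range' 0 (ν + 2)).map fun i => min (T i) 1 := ⟨_, rfl⟩
  obtain ⟨out2, hout2⟩ : ∃ o, o = out1 ++ [1] := ⟨_, rfl⟩
  obtain ⟨out3, hout3⟩ : ∃ o, o = out2 ++ (List.range' 0 (ν + 2)).map fun i => T i - 1 := ⟨_, rfl⟩
  have l1 : out1.length = out.length + (ν + 2) := by simp [hout1]
  have l2 : out2.length = out.length + (ν + 3) := by simp [hout2, l1]; ring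
  have l3 : out3.length = out.length + (2 * ν + 5) := by simp [hout3, l2]; ring
  have h1 : Run V 3 (block [copy 14 2, copy 16 11])
      ([1, out.length, ν + 2, c, X, B, n, a, 0, 0, (ν + 1) * (ν + 3), F, q, b, 0, e, f],
        mem out F T)
      ([1, out.length, ν + 2, c, X, B, n, a, 0, 0, (ν + 1) * (ν + 3), F, q, b, ν + 2, e, F + 0],
        mem out F T) := by
    refine Run.block ?_ ?_
    · simp [OkAll, Ok, step]
      omega
    · simp [steps, step]
  have h2 := run_nbrLoop (V := V) (F := F) (ν := ν + 2) (c := c) (X := X) (B := B) (n := n)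
    (a := a) (s := (ν + 1) * (ν + 3)) (q := q) (b := b) (e := e) (ν + 2) 0 out T (by omega)
    (by omega) (by omega) hT
  rw [← hout1] at h2
  have h3 : Run V 5 (block [store 1 0, add 1 1 0, copy 14 2, copy 16 11])
      ([1, out.length + (ν + 2), ν + 2, c, X, B, n, a, 0, 0, (ν + 1) * (ν + 3), F, q, b, 0, e,
        F + 0 + (ν + 2)], mem out1 F T)
      ([1, out2.length, ν + 2, c, X, B, n, a, 0, 0, (ν + 1) * (ν + 3), F, q, b, ν + 2, e, F + 0],
        mem out2 F T) := by
    rw [l2, ← l1]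
    refine Run.block ?_ ?_
    · simp [OkAll, Ok, step]
      omega
    · simp [steps, step, update_mem_end T 1 (rfl : out1.length = out1.length) (show _ < F by omega), ← hout2]
      omega
  have h4 := run_premiseLoop (V := V) (F := F) (ν := ν + 2) (c := c) (X := X) (B := B) (n := n)
    (a := a) (s := (ν + 1) * (ν + 3)) (q := q) (b := b) (e := e) (ν + 2) 0 out2 T (by omega)
    (by omega) (by omega) hT
  rw [← hout3] at h4
  have e5 : out ++ blockOf ν (T, e) =
      out3 ++ [e] ++ [e] ++ List.replicate ((ν + 1) * (ν + 3)) 0 := by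
    simp [hout3, hout2, hout1, blockOf, List.range_eq_range']
  have l5 : (out ++ blockOf ν (T, e)).length =
      out2.length + (ν + 2) + 1 + 1 + (ν + 1) * (ν + 3) := by
    rw [List.length_append, length_blockOf]; omega
  have h5 : Run V 6 (block [store 1 15, add 1 1 0, store 1 15, add 1 1 0, add 1 1 10])
      ([1, out2.length + (ν + 2), ν + 2, c, X, B, n, a, 0, 0, (ν + 1) * (ν + 3), F, q, b, 0, e,
        F + 0 + (ν + 2)], mem out3 F T)
      ([1, (out ++ blockOf ν (T, e)).length, ν + 2, c, X, B, n, a, 0, 0, (ν + 1) * (ν + 3), F, q, b,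
        0, e, F + (ν + 2)], mem (out ++ blockOf ν (T, e)) F T) := by
    have u1 := update_mem_end (p := out2.length + (ν + 2)) (out := out3) (F := F) T e (by omega)
      (by omega)
    have u2 := update_mem_end (p := out2.length + (ν + 2) + 1) (out := out3 ++ [e]) (F := F) T e
      (by rw [List.length_append, List.length_singleton]; omega) (by omega)
    rw [l5, e5, mem_append_zeros _ (by
      simp only [List.length_append, List.length_singleton]; omega)]
    refine Run.block ?_ ?_
    · simp [OkAll, Ok, step]
      omega
    · simp only [steps, step]
      simp [u1, u2]
  exact (h1.seq (h2.seq (h3.seq (h4.seq h5)))).mono (by omega)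

end

section
variable {V ν F : ℕ}

theorem run_popToken {B c n a s p t : ℕ} {l : List ℕ} {M : ℕ → ℕ} (ht : t < B)
    (hX : pack B (t :: l) ≤ V) (hB : B ≤ V) (h2 : 2 ≤ V) :
    Run V 11 (block popToken)
      ([1, p, ν, c, pack B (t :: l), B, n, a, 0, 0, s, F, 0, 0, 0, 0, 0], M)
      ([1, p, ν, c, pack B l, B, n, a, 0, 0, s, F, t / 2, t % 2, 0, 0, 0], M) := by
  have e1 : (pack B l * B + t) / B = pack B l := by
    rw [Nat.mul_comm, Nat.mul_add_div (by omega), Nat.div_eq_of_lt ht, add_zero]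
  have e2 : t - (t / 2 + t / 2) = t % 2 := by omega
  have e3 := le_pack_cons (B := B) (by omega) t l
  simp only [pack] at hX e3 ⊢
  refine Run.block ?_ ?_
  · simp [popToken, OkAll, Ok, step, e1]
    omega
  · simp [popToken, steps, step, e1, e2]

theorem run_setLiteral {c X B n p s t : ℕ} {out : List ℕ} {x : Partial} (hx : x.WF ν)
    (ht : t ≤ 2 * ν + 1) (h0 : t / 2 ≠ 0) (hF : out.length ≤ F) (hV : F + ν + 2 ≤ V)
    (h3 : 3 ≤ V) :
    Run V 23 (block setLiteral)
      ([1, p, ν + 2, c, X, B, n, x.2, 0, 0, s, F, t / 2, t % 2, 0, 0, 0], mem out F x.1)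
      ([1, p, ν + 2, c, X, B, n, (next ν x t).2, 0, 0, s, F, t / 2, 2 - t % 2, 0,
        (voter ν x t).2, F + t / 2], mem out F (voter ν x t).1) := by
  have hu := hx.le_two (t / 2)
  have hf := hx.flag
  have hb : t % 2 < 2 := Nat.mod_lt _ (by omega)
  have hq : t / 2 ≤ ν := by omega
  simp only [next, voter, if_neg h0]
  have key : ∀ u b q, u ≤ 2 → b < 2 → q ≤ ν → x.1 q = u → Run V 23 (block setLiteral)
      ([1, p, ν + 2, c, X, B, n, x.2, 0, 0, s, F, q, b, 0, 0, 0], mem out F x.1)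
      ([1, p, ν + 2, c, X, B, n, if u = b + 1 then 0 else x.2, 0, 0, s, F, q, 2 - b, 0,
        if u = 2 - b then 0 else x.2, F + q], mem out F (Function.update x.1 q (b + 1))) := by
    intro u b q hu hb hq hxu
    have hm := mem_table (out := out) (F := F) x.1 q hF
    rw [hxu] at hm
    have hup := update_mem_table (out := out) (F := F) x.1 q (b + 1) hF
    have e1 : x.2 * (u - (2 - b) + (2 - b - u) - (u - (2 - b) + (2 - b - u) - 1)) =
        if u = 2 - b then 0 else x.2 := by
      split_ifs with h
      · rw [show u - (2 - b) + (2 - b - u) - (u - (2 - b) + (2 - b - u) - 1) = 0 by omega, mul_zero]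
      · rw [show u - (2 - b) + (2 - b - u) - (u - (2 - b) + (2 - b - u) - 1) = 1 by omega, mul_one]
    have e2 : x.2 * (u - (b + 1) + (b + 1 - u) - (u - (b + 1) + (b + 1 - u) - 1)) =
        if u = b + 1 then 0 else x.2 := by
      split_ifs with h
      · rw [show u - (b + 1) + (b + 1 - u) - (u - (b + 1) + (b + 1 - u) - 1) = 0 by omega, mul_zero]
      · rw [show u - (b + 1) + (b + 1 - u) - (u - (b + 1) + (b + 1 - u) - 1) = 1 by omega, mul_one]
    refine Run.block ?_ ?_
    · simp [setLiteral, OkAll, Ok, step, hm]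
      omega
    · simp only [setLiteral, steps, step, List.getD_cons_succ, List.getD_cons_zero, List.set_cons_succ,
        List.set_cons_zero, hm, hup, e1, e2]
      simp
  exact key _ _ _ hu hb hq rfl

theorem run_emitToken {c n t : ℕ} {l : List ℕ} (out : List ℕ) {x : Partial} (hx : x.WF ν)
    (ht : t ≤ 2 * ν + 1) (hF : out.length + (2 * (ν + 2) + 3 + (ν + 1) * (ν + 3)) ≤ F)
    (hV : F + ν + 2 ≤ V) (hB : 2 * ν + 4 ≤ V) (hX : pack (2 * ν + 4) (t :: l) ≤ V) (hc : c < V) :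
    Run V (30 * ν + 200) emitToken
      ([1, out.length, ν + 2, c + 1, pack (2 * ν + 4) (t :: l), 2 * ν + 4, n, x.2, 0, 0,
        (ν + 1) * (ν + 3), F, 0, 0, 0, 0, 0], mem out F x.1)
      ([1, (out ++ blockOf ν (voter ν x t)).length, ν + 2, c, pack (2 * ν + 4) l, 2 * ν + 4, n,
        (next ν x t).2, 0, 0, (ν + 1) * (ν + 3), F, 0, 0, 0, 0, 0],
        mem (out ++ blockOf ν (voter ν x t)) F (next ν x t).1) := by
  have hl : (out ++ blockOf ν (voter ν x t)).length ≤ F := by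
    rw [List.length_append, length_blockOf]
    exact hF
  have hl0 : out.length ≤ F := by omega
  have h1 := run_popToken (V := V) (ν := ν + 2) (F := F) (c := c + 1) (n := n) (a := x.2)
    (s := (ν + 1) * (ν + 3)) (p := out.length) (l := l) (M := mem out F x.1)
    (show t < 2 * ν + 4 by omega) hX hB (by omega)
  have hv := hx.voter ht
  have hn := hx.next ht
  have hve := hv.flag
  have hne := hn.flag
  have hvt := hv.le_two
  have hend : ∀ q b e f, Run V 6 (block [const 12 0, const 13 0, const 15 0, const 16 0, sub 3 3 0])
      ([1, (out ++ blockOf ν (voter ν x t)).length, ν + 2, c + 1, pack (2 * ν + 4) l, 2 * ν + 4, n,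
        (next ν x t).2, 0, 0, (ν + 1) * (ν + 3), F, q, b, 0, e, f],
        mem (out ++ blockOf ν (voter ν x t)) F (next ν x t).1)
      ([1, (out ++ blockOf ν (voter ν x t)).length, ν + 2, c, pack (2 * ν + 4) l, 2 * ν + 4, n,
        (next ν x t).2, 0, 0, (ν + 1) * (ν + 3), F, 0, 0, 0, 0, 0],
        mem (out ++ blockOf ν (voter ν x t)) F (next ν x t).1) := by
    intro q b e f
    generalize (out ++ blockOf ν (voter ν x t)).length = p
    refine Run.block ?_ ?_
    · simp [OkAll, Ok, step]
      omega
    · simp [steps, step]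
  have hmid := fun a q b f => run_emitVoter (V := V) (F := F) (ν := ν) (c := c + 1)
    (X := pack (2 * ν + 4) l) (B := 2 * ν + 4) (n := n) (a := a) (q := q) (b := b) (f := f) out
    (voter ν x t) hF hV (fun i => (hvt i).trans (by omega)) (by omega)
  by_cases h0 : t / 2 = 0
  · have ev : (voter ν x t) = (setRange x.1 1 1 (ν + 1), 0) := by
      simp only [voter, if_pos h0]
      congr 1
      funext k
      congr 1
      apply propext
      omega
    have en : next ν x t = (setRange (setRange x.1 1 1 (ν + 1)) 0 1 (ν + 1), 1) := by
      simp only [next, if_pos h0]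
      congr 1
      funext k
      simp only [setRange]
      by_cases hk : 1 ≤ k ∧ k ≤ ν + 1
      · rw [if_pos hk, if_pos (by omega)]
      · rw [if_neg hk, if_neg (by omega), if_neg (by omega)]
    rw [ev, en] at hend
    rw [ev] at hmid hl
    rw [h0] at h1
    rw [ev, en]
    have h2 := run_fill (V := V) (ν := ν) (F := F) (p := out.length) (c := c + 1)
      (X := pack (2 * ν + 4) l) (B := 2 * ν + 4) (n := n) (a := x.2) (s := (ν + 1) * (ν + 3))
      (q := 0) (b := t % 2) (e := 0) (x := 1) (f := 0) (out := out) x.1 hl0 hV (by omega)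
    have h3 : Run V 2 (block [const 15 0])
        ([1, out.length, ν + 2, c + 1, pack (2 * ν + 4) l, 2 * ν + 4, n, x.2, 0, 0,
          (ν + 1) * (ν + 3), F, 0, t % 2, 0, 0, F + 1 + (ν + 1)],
          mem out F (setRange x.1 1 1 (ν + 1)))
        ([1, out.length, ν + 2, c + 1, pack (2 * ν + 4) l, 2 * ν + 4, n, x.2, 0, 0,
          (ν + 1) * (ν + 3), F, 0, t % 2, 0, 0, F + 1 + (ν + 1)],
          mem out F (setRange x.1 1 1 (ν + 1))) := by
      refine Run.block ?_ ?_
      · simp [OkAll, Ok]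
      · simp [steps, step]
    have h4 := run_fill (V := V) (ν := ν) (F := F)
      (p := (out ++ blockOf ν (setRange x.1 1 1 (ν + 1), 0)).length) (c := c + 1)
      (X := pack (2 * ν + 4) l) (B := 2 * ν + 4) (n := n) (a := x.2) (s := (ν + 1) * (ν + 3))
      (q := 0) (b := t % 2) (e := 0) (x := 0) (f := F + (ν + 2))
      (out := out ++ blockOf ν (setRange x.1 1 1 (ν + 1), 0)) (setRange x.1 1 1 (ν + 1)) hl hV
      (by omega)
    have h5 : Run V 2 (block [const 7 1])
        ([1, (out ++ blockOf ν (setRange x.1 1 1 (ν + 1), 0)).length, ν + 2, c + 1,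
          pack (2 * ν + 4) l, 2 * ν + 4, n, x.2, 0, 0, (ν + 1) * (ν + 3), F, 0, t % 2, 0, 0,
          F + 1 + (ν + 1)], mem (out ++ blockOf ν (setRange x.1 1 1 (ν + 1), 0)) F
            (setRange (setRange x.1 1 1 (ν + 1)) 0 1 (ν + 1)))
        ([1, (out ++ blockOf ν (setRange x.1 1 1 (ν + 1), 0)).length, ν + 2, c + 1,
          pack (2 * ν + 4) l, 2 * ν + 4, n, 1, 0, 0, (ν + 1) * (ν + 3), F, 0, t % 2, 0, 0,
          F + 1 + (ν + 1)], mem (out ++ blockOf ν (setRange x.1 1 1 (ν + 1), 0)) F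
            (setRange (setRange x.1 1 1 (ν + 1)) 0 1 (ν + 1))) := by
      refine Run.block ?_ ?_
      · simp only [OkAll, Ok]
        simp
        omega
      · simp only [steps, step]
        simp
    exact (h1.seq ((Run.ite_false rfl (h2.seq h3)).seq ((hmid _ _ _ _).seq
      ((Run.ite_false rfl (h4.seq h5)).seq (hend _ _ _ _))))).mono (by omega)
  · have h2 := run_setLiteral (V := V) (c := c + 1) (X := pack (2 * ν + 4) l) (B := 2 * ν + 4)
      (n := n) (p := out.length) (s := (ν + 1) * (ν + 3)) hx ht h0 hl0 hV (by omega)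
    have en : (next ν x t).1 = Function.update (voter ν x t).1 (t / 2) (2 - t % 2) := by
      simp [next, voter, h0]
    have hq : t / 2 ≤ ν := by omega
    have h4 : Run V 3 (block [add 16 11 12, store 16 13])
        ([1, (out ++ blockOf ν (voter ν x t)).length, ν + 2, c + 1, pack (2 * ν + 4) l, 2 * ν + 4,
          n, (next ν x t).2, 0, 0, (ν + 1) * (ν + 3), F, t / 2, 2 - t % 2, 0, (voter ν x t).2,
          F + (ν + 2)], mem (out ++ blockOf ν (voter ν x t)) F (voter ν x t).1)
        ([1, (out ++ blockOf ν (voter ν x t)).length, ν + 2, c + 1, pack (2 * ν + 4) l, 2 * ν + 4,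
          n, (next ν x t).2, 0, 0, (ν + 1) * (ν + 3), F, t / 2, 2 - t % 2, 0, (voter ν x t).2,
          F + t / 2], mem (out ++ blockOf ν (voter ν x t)) F (next ν x t).1) := by
      have hup := update_mem_table (voter ν x t).1 (t / 2) (2 - t % 2) hl
      rw [← en] at hup
      refine Run.block ?_ ?_
      · simp only [OkAll, Ok, step]
        simp
        omega
      · simp only [steps, step, List.getD_cons_succ, List.getD_cons_zero, List.set_cons_succ,
          List.set_cons_zero, hup]
    refine (h1.seq ((Run.ite_true ?_ ?_ h2).seq ((hmid _ _ _ _).seq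
      ((Run.ite_true ?_ ?_ h4).seq (hend _ _ _ _))))).mono (by omega)
    · exact h0
    · exact show t / 2 ≤ V by omega
    · exact h0
    · exact show t / 2 ≤ V by omega

theorem run_emitTokens {n : ℕ} (l : List ℕ) (out : List ℕ) {x : Partial} (hx : x.WF ν)
    (hl : ∀ t ∈ l, t ≤ 2 * ν + 1)
    (hF : out.length + l.length * (2 * (ν + 2) + 3 + (ν + 1) * (ν + 3)) ≤ F)
    (hV : F + ν + 2 ≤ V) (hB : 2 * ν + 4 ≤ V) (hX : pack (2 * ν + 4) l ≤ V) (hc : l.length ≤ V) :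
    Run V (l.length * (30 * ν + 201) + 1) (loop 3 emitToken)
      ([1, out.length, ν + 2, l.length, pack (2 * ν + 4) l, 2 * ν + 4, n, x.2, 0, 0,
        (ν + 1) * (ν + 3), F, 0, 0, 0, 0, 0], mem out F x.1)
      ([1, (out ++ (voters ν x l).flatMap (blockOf ν)).length, ν + 2, 0, 0, 2 * ν + 4, n,
        (l.foldl (next ν) x).2, 0, 0, (ν + 1) * (ν + 3), F, 0, 0, 0, 0, 0],
        mem (out ++ (voters ν x l).flatMap (blockOf ν)) F (l.foldl (next ν) x).1) := by
  induction l generalizing out x with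
  | nil => simpa [voters, pack] using Run.loop_false rfl
  | cons t l ih =>
    have ht := hl t (by simp)
    rw [List.length_cons, add_mul, one_mul] at hF
    rw [List.length_cons] at hc
    have h := ih (out ++ blockOf ν (voter ν x t)) (hx.next ht) (fun t' h' => hl t' (by simp [h']))
      (by rw [List.length_append, length_blockOf]; omega)
      ((le_pack_cons (by omega) _ _).trans hX) (by omega)
    have h1 := run_emitToken (V := V) (F := F) (c := l.length) (n := n) (l := l) out hx ht (by omega)
      hV hB hX (by omega)
    rw [List.append_assoc] at h
    refine (Run.loop_true (by simp) (by simpa using hc) h1 h).mono ?_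
    rw [List.length_cons, add_mul]
    omega

end

/-! ### The complete program -/

theorem tokens_eq_append (φ : SAT.Formula) : ∃ l, tokens φ = l ++ [0] := by
  have : ∀ (cs : List (List (Fin φ.ν × Bool))) (acc : List ℕ), (∃ l, acc = l ++ [0]) →
      ∃ l, cs.foldl pushClause acc = l ++ [0] := by
    intro cs
    induction cs with
    | nil => exact fun acc h => h
    | cons c cs ih =>
      rintro acc ⟨l, rfl⟩
      exact ih _ ⟨c.reverse.map token ++ 0 :: l, by rw [pushClause_eq]; simp⟩
  exact this _ _ ⟨[], rfl⟩

/-- The last token is a terminator, so the table ends up empty and leaves no trace behind the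
output. -/
theorem foldl_next_tokens (φ : SAT.Formula) : (tokens φ).foldl (next φ.ν) blank = blank := by
  have h : ∀ (l : List ℕ) (x : Partial), x.WF φ.ν → (∀ t ∈ l, t ≤ 2 * φ.ν + 1) →
      (l.foldl (next φ.ν) x).WF φ.ν := by
    intro l
    induction l with
    | nil => exact fun x hx _ => hx
    | cons t l ih =>
      exact fun x hx hl => ih _ (hx.next (hl t (by simp))) fun t' h' => hl t' (by simp [h'])
  have ht := tokens_le φ
  obtain ⟨l, hl⟩ := tokens_eq_append φ
  rw [hl] at ht ⊢
  rw [List.foldl_append]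
  exact next_of_lt_two (t := 0) (h l _ (wf_blank _) fun t h' => ht t (by simp [h'])) rfl

/-- An address beyond the encoding of the profile. -/
def tableAddress (φ : SAT.Formula) : ℕ :=
  φ.ν + 2 + (φ.ν + 2) + (φ.ν + 2) +
    ((φ.ν + 2 + 1) * (φ.ν + 2 + 1) + 1) * (tokens φ).length + 3

theorem length_encode_profile (φ : SAT.Formula) :
    ((profile φ).encode (target φ)).length = tableAddress φ := by
  rw [profile, encode_profileOf (wf_votersOf φ)]
  simp only [List.length_cons, List.length_append, length_flatMap_blockOf, length_votersOf,
    tableAddress]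
  simp
  ring

theorem run_reduction {V : ℕ} (φ : SAT.Formula) (hL : φ.encode.length ≤ V)
    (hX : pack (2 * φ.ν + 4) (tokens φ) ≤ V) (hF : tableAddress φ + φ.ν + 2 ≤ V) :
    Run V (300 * (φ.encode.length + 1) * (φ.ν + 1)) reduction
      (List.replicate 17 0, tape 0 φ.encode)
      (List.replicate 17 0, tape 0 ((profile φ).encode (target φ))) := by
  have hn := length_tokens_lt φ
  have hc := length_clauses_le φ
  have hlen := length_encode_profile φ
  have hn0 : 1 ≤ (tokens φ).length := by rw [length_tokens]; omega
  have hFlow : (φ.ν + 3) * (φ.ν + 3) + 1 + 3 + 3 * (φ.ν + 2) ≤ tableAddress φ := by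
    unfold tableAddress
    have := Nat.le_mul_of_pos_right ((φ.ν + 2 + 1) * (φ.ν + 2 + 1) + 1) hn0
    rw [show (φ.ν + 3) = φ.ν + 2 + 1 from rfl]
    omega
  have hν2 : 9 + 6 * φ.ν ≤ (φ.ν + 3) * (φ.ν + 3) := by nlinarith
  have hnm : (tokens φ).length * (φ.ν + 2) ≤ tableAddress φ := by
    unfold tableAddress
    nlinarith
  have hz : (φ.ν + 1) * (φ.ν + 3) ≤ (φ.ν + 3) * (φ.ν + 3) := Nat.mul_le_mul_right _ (by omega)
  have e := encode_profileOf (wf_votersOf φ) (target φ)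
  rw [length_votersOf] at e
  obtain ⟨F, hFe⟩ : ∃ F, F = tableAddress φ := ⟨_, rfl⟩
  obtain ⟨n, hne⟩ : ∃ n, n = (tokens φ).length := ⟨_, rfl⟩
  have h1 := run_readFormula (V := V) φ (by omega) hL hX
  have h2 : Run V 23 (block emitHead)
      ([1, φ.encode.length, φ.ν, 0, pack (2 * φ.ν + 4) (tokens φ), 2 * φ.ν + 4,
        (tokens φ).length, 0, 0, 0, φ.clauses.length, 0, 0, 0, 0, 0, 0], fun _ => 0)
      ([1, [φ.ν + 2, n, target φ].length, φ.ν + 2, 0, pack (2 * φ.ν + 4) (tokens φ), 2 * φ.ν + 4,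
        n, 0, 2, 0, target φ, F, 0, 0, φ.ν + 2, 0, 0],
        mem [φ.ν + 2, n, target φ] F blank.1) := by
    have hm : (fun _ => 0 : ℕ → ℕ) = mem [] F blank.1 := by
      funext a; simp [mem, blank]
    rw [hm, ← hne]
    have u1 := update_mem_end (out := []) (F := F) (p := 0) blank.1 (φ.ν + 2) rfl (by omega)
    have u2 := update_mem_end (out := [φ.ν + 2]) (F := F) (p := 1) blank.1 n rfl (by omega)
    have u3 := update_mem_end (out := [φ.ν + 2, n]) (F := F) (p := 2) blank.1 (target φ) rfl
      (by omega)
    have et : n * (φ.ν + 2) - φ.clauses.length = target φ := by rw [hne]; rfl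
    have eF : φ.ν + 2 + (φ.ν + 2) + (φ.ν + 2) + ((φ.ν + 2 + 1) * (φ.ν + 2 + 1) + 1) * n + 3 = F := by
      rw [hFe, hne]; rfl
    have htle : target φ ≤ n * (φ.ν + 2) := by rw [← et]; omega
    rw [← hne] at hnm hn
    have hsq : (φ.ν + 2 + 1) * (φ.ν + 2 + 1) = (φ.ν + 3) * (φ.ν + 3) := rfl
    refine Run.block ?_ ?_
    · simp [emitHead, OkAll, Ok, step, et, eF]
      omega
    · simp only [emitHead, steps, step, List.getD_cons_succ, List.getD_cons_zero,
        List.set_cons_succ, List.set_cons_zero, zero_add, Nat.reduceAdd, u1, et, eF]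
      simp [u2, u3]
  have h3 := run_emitDomain (V := V) (F := F) (ν := φ.ν + 2) (n := n) (s := target φ)
    (B := 2 * φ.ν + 4) (X := pack (2 * φ.ν + 4) (tokens φ)) (φ.ν + 2) [φ.ν + 2, n, target φ] blank.1
    (by simp; omega) (by omega) (by omega)
  obtain ⟨out, hout⟩ : ∃ o, o = [φ.ν + 2, n, target φ] ++
    (List.replicate (φ.ν + 2) [2, 0, 1]).flatten := ⟨_, rfl⟩
  have lout : out.length = [φ.ν + 2, n, target φ].length + 3 * (φ.ν + 2) := by
    rw [hout]; simp; ring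
  rw [← hout, ← lout] at h3
  have h4 : Run V 8 (block prepareVoters)
      ([1, out.length, φ.ν + 2, 0, pack (2 * φ.ν + 4) (tokens φ), 2 * φ.ν + 4,
        n, 0, 2, 0, target φ, F, 0, 0, 0, 0, 0], mem out F blank.1)
      ([1, out.length, φ.ν + 2, (tokens φ).length, pack (2 * φ.ν + 4) (tokens φ), 2 * φ.ν + 4,
        n, blank.2, 0, 0, (φ.ν + 1) * (φ.ν + 3), F, 0, 0, 0, 0, 0], mem out F blank.1) := by
    refine Run.block ?_ ?_
    · simp [prepareVoters, OkAll, Ok, step]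
      omega
    · simp [prepareVoters, steps, step, hne, blank]
  have hfin : out ++ (voters φ.ν blank (tokens φ)).flatMap (blockOf φ.ν) =
      (profile φ).encode (target φ) := by
    rw [profile, e, hout, hne]
    simp [votersOf]
  have h5 := run_emitTokens (V := V) (ν := φ.ν) (F := F) (n := n) (tokens φ) out (wf_blank φ.ν)
    (tokens_le φ) (by
      rw [← hfin, List.length_append, length_flatMap_blockOf, length_voters] at hlen
      omega) (by omega) (by omega) hX (by omega)
  rw [foldl_next_tokens, hfin, hlen, ← hFe] at h5
  have h6 : Run V 9 (block [const 0 0, const 1 0, const 2 0, const 5 0, const 6 0, const 7 0,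
        const 10 0, const 11 0])
      ([1, F, φ.ν + 2, 0, 0, 2 * φ.ν + 4, n, blank.2, 0, 0, (φ.ν + 1) * (φ.ν + 3), F, 0, 0, 0, 0,
        0], mem ((profile φ).encode (target φ)) F blank.1)
      (List.replicate 17 0, tape 0 ((profile φ).encode (target φ))) := by
    refine Run.block ?_ ?_
    · simp [OkAll, Ok, step]
    · simp only [steps, step, List.set_cons_succ, List.set_cons_zero]
      refine Prod.ext rfl ?_
      funext a
      simp only [mem, tape, blank, Nat.not_lt_zero, if_false, Nat.sub_zero]
      split_ifs with h
      · rfl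
      · rw [List.getD_eq_default _ _ (by omega)]
      · rw [List.getD_eq_default _ _ (by omega)]
  refine (h1.seq (h2.seq (h3.seq (h4.seq (h5.seq h6))))).mono ?_
  nlinarith [Nat.mul_le_mul_right (30 * φ.ν + 201) hn.le]

/-! ## Running time -/

theorem length_le_wordSize (w : List ℕ) : w.length ≤ wordSize w := by
  induction w with
  | nil => simp
  | cons a w ih =>
    have := one_le_len a
    simp only [wordSize, List.map_cons, List.sum_cons, List.length_cons] at ih ⊢
    omega

theorem wordSize_le {w : List ℕ} {M : ℕ} (h : ∀ a ∈ w, a ≤ M) :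
    wordSize w ≤ w.length * (M + 1) := by
  induction w with
  | nil => simp [wordSize]
  | cons a w ih =>
    have h1 := ih fun b hb => h b (by simp [hb])
    have h2 : Nat.size a ≤ M := (Nat.size_le.2 Nat.lt_two_pow_self).trans (h a (by simp))
    simp only [wordSize, List.map_cons, List.sum_cons, List.length_cons] at h1 ⊢
    rw [add_mul]
    have : len a = Nat.size a + 1 := rfl
    omega

theorem toState_tape (w : List ℕ) : Conf.toState (List.replicate 17 0, tape 0 w) = start w := by
  unfold Conf.toState start
  congr 1
  funext i
  simp only [List.getD_eq_getElem?_getD, List.getElem?_replicate]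
  split_ifs <;> rfl

theorem length_tokens_lt_size (φ : SAT.Formula) : (tokens φ).length < φ.size :=
  (length_tokens_lt φ).trans_le (length_le_wordSize _)

theorem tableAddress_add_le (φ : SAT.Formula) :
    tableAddress φ + φ.ν + 2 ≤ 21 * (φ.ν + 1) ^ 2 * φ.size := by
  have hn := length_tokens_lt_size φ
  have h1 : ((φ.ν + 2 + 1) * (φ.ν + 2 + 1) + 1) * (tokens φ).length ≤
      10 * (φ.ν + 1) ^ 2 * φ.size :=
    Nat.mul_le_mul (by nlinarith) hn.le
  have h2 : 4 * φ.ν + 11 ≤ 11 * (φ.ν + 1) ^ 2 * φ.size :=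
    le_trans (by nlinarith) (Nat.le_mul_of_pos_right _ (by omega))
  unfold tableAddress
  linarith

/-- `tableAddress φ` bounds both the number of entries and every entry, whence the square. -/
theorem size_profile_le (φ : SAT.Formula) :
    (profile φ).size (target φ) ≤ 500 * ((φ.ν + 1) ^ 4 * φ.size ^ 2) := by
  have h := tableAddress_add_le φ
  have hn := length_tokens_lt_size φ
  have hF : ∀ a ∈ (profile φ).encode (target φ), a ≤ tableAddress φ := by
    have hn0 : (tokens φ).length * (φ.ν + 2) ≤ tableAddress φ := by
      unfold tableAddress
      nlinarith
    have hn1 : (tokens φ).length ≤ (tokens φ).length * (φ.ν + 2) :=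
      Nat.le_mul_of_pos_right _ (by omega)
    have hm : φ.ν + 5 ≤ tableAddress φ := by
      unfold tableAddress
      omega
    intro a ha
    rw [profile, encode_profileOf (wf_votersOf φ), length_votersOf] at ha
    simp only [List.mem_cons, List.mem_append, List.mem_flatten, List.mem_replicate,
      List.mem_flatMap] at ha
    rcases ha with rfl | rfl | rfl | ⟨l, ⟨-, rfl⟩, ha⟩ | ⟨x, hx, ha⟩
    · omega
    · omega
    · unfold target; omega
    · simp at ha; omega
    · have h2 := (wf_votersOf φ x hx).le_two
      have hf := (wf_votersOf φ x hx).flag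
      have : a ≤ 2 := by
        simp only [blockOf, List.mem_append, List.mem_map, List.mem_cons, List.mem_replicate] at ha
        rcases ha with ⟨k, -, rfl⟩ | rfl | ⟨k, -, rfl⟩ | rfl | rfl | ⟨-, rfl⟩
        all_goals first | omega | (have := h2 k; omega)
      omega
  have hs := wordSize_le hF
  rw [length_encode_profile] at hs
  refine hs.trans ((Nat.mul_le_mul (show _ ≤ 21 * (φ.ν + 1) ^ 2 * φ.size by omega)
    (show _ ≤ 21 * (φ.ν + 1) ^ 2 * φ.size by omega)).trans ?_)
  have : 21 * (φ.ν + 1) ^ 2 * φ.size * (21 * (φ.ν + 1) ^ 2 * φ.size) =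
    441 * ((φ.ν + 1) ^ 4 * φ.size ^ 2) := by ring
  rw [this]
  exact Nat.mul_le_mul_right _ (by omega)

theorem exec_reduction (φ : SAT.Formula) :
    ∃ t, Exec reduction (start φ.encode) (start ((profile φ).encode (target φ))) t ∧
      t ≤ 31200 * ((φ.ν + 1) ^ 3 * φ.size ^ 2) := by
  have hn := length_tokens_lt_size φ
  have hL : φ.encode.length ≤ φ.size := length_le_wordSize _
  have hF := tableAddress_add_le φ
  -- All numbers handled stay below `2 ^ K`: the packed tokens have at most `φ.ν + 2` bits each.
  -- Only the bit length, about `K`, enters the cost.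
  set K := (φ.ν + 2) * (tokens φ).length + (tableAddress φ + φ.ν + 2) + φ.encode.length with hK
  have hpow : ∀ {a}, a ≤ K → a ≤ 2 ^ K := fun h => h.trans Nat.lt_two_pow_self.le
  have hB : 2 * φ.ν + 4 ≤ 2 ^ (φ.ν + 2) := by
    have : φ.ν + 1 < 2 ^ (φ.ν + 1) := Nat.lt_two_pow_self
    rw [pow_succ]
    omega
  have hX : pack (2 * φ.ν + 4) (tokens φ) ≤ 2 ^ K := by
    refine (pack_lt_pow fun t ht => ?_).le.trans ((Nat.pow_le_pow_left hB _).trans ?_)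
    · have := tokens_le φ t ht
      omega
    · rw [← pow_mul]
      exact Nat.pow_le_pow_right (by omega) (by omega)
  obtain ⟨t, h, ht⟩ := run_reduction (V := 2 ^ K) φ (hpow (by omega)) hX (hpow (by omega))
  rw [toState_tape, toState_tape] at h
  refine ⟨t, h, ht.trans ?_⟩
  have hlen : len (2 ^ K) = K + 2 := by unfold len; rw [Nat.size_pow]
  have h1 : (φ.ν + 2) * (tokens φ).length ≤ 2 * (φ.ν + 1) ^ 2 * φ.size :=
    Nat.mul_le_mul (by nlinarith) hn.le
  have h2 : φ.size ≤ (φ.ν + 1) ^ 2 * φ.size := Nat.le_mul_of_pos_left _ (by positivity)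
  have hK' : K + 2 ≤ 26 * ((φ.ν + 1) ^ 2 * φ.size) := by nlinarith
  rw [hlen]
  calc 300 * (φ.encode.length + 1) * (φ.ν + 1) * (2 * (K + 2))
      ≤ 300 * (2 * φ.size) * (φ.ν + 1) * (2 * (26 * ((φ.ν + 1) ^ 2 * φ.size))) := by
        gcongr
        omega
    _ = 31200 * ((φ.ν + 1) ^ 3 * φ.size ^ 2) := by ring

/-! ### Exponential against polynomial factors -/

/-- A polynomial factor is absorbed by a larger base. -/
theorem exists_pow_mul_pow_le {β γ : ℝ} (hβ : 0 < β) (h : β < γ) (k : ℕ) :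
    ∃ D : ℕ, ∀ ν : ℕ, ((ν : ℝ) + 1) ^ k * β ^ ν ≤ D * γ ^ ν := by
  have hr : 1 < γ / β := (one_lt_div hβ).2 h
  obtain ⟨M, hM⟩ := (tendsto_pow_const_div_const_pow_of_one_lt k hr).bddAbove_range
  obtain ⟨D, hD⟩ := exists_nat_ge (M * (γ / β))
  refine ⟨D, fun ν => ?_⟩
  -- The bounded sequence is used at index `ν + 1`; the factor `γ / β` in `D` pays for the shift.
  have h1 : ((ν + 1 : ℕ) : ℝ) ^ k / (γ / β) ^ (ν + 1) ≤ M := hM ⟨ν + 1, rfl⟩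
  rw [div_le_iff₀ (by positivity), pow_succ] at h1
  have hγ : 0 < γ := hβ.trans h
  calc ((ν : ℝ) + 1) ^ k * β ^ ν ≤ M * ((γ / β) ^ ν * (γ / β)) * β ^ ν := by
        gcongr
        exact_mod_cast h1
    _ = M * (γ / β) * γ ^ ν := by rw [div_pow]; field_simp
    _ ≤ D * γ ^ ν := by gcongr

theorem solvableInTime_of_cms {ε : ℝ} {C c : ℕ}
    (h : CMS.SolvableInTime fun P s =>
      C * (P.d : ℝ) ^ ((1 - ε) * (P.m : ℝ)) * (P.size s : ℝ) ^ c) (k : ℕ) :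
    SAT.SolvableInTime k fun φ => 31200 * (((φ.ν : ℝ) + 1) ^ 3 * (φ.size : ℝ) ^ 2) +
      C * ((2 : ℝ) ^ (1 - ε)) ^ (φ.ν + 2) *
        (500 * (((φ.ν : ℝ) + 1) ^ 4 * (φ.size : ℝ) ^ 2)) ^ c := by
  obtain ⟨p, hp⟩ := h
  refine ⟨seq reduction p, fun φ _ => ?_⟩
  obtain ⟨t₁, h₁, ht₁⟩ := exec_reduction φ
  obtain ⟨τ, t₂, h₂, ht₂, ha⟩ := hp (profile φ) (target φ) (noIsolatedIssue_profile φ)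
  refine ⟨τ, t₁ + t₂, h₁.seq h₂, ?_, ?_⟩
  · push_cast
    refine add_le_add (by exact_mod_cast ht₁) (ht₂.trans ?_)
    have hm : (profile φ).m = φ.ν + 2 := rfl
    have hs : ((profile φ).size (target φ) : ℝ) ≤
        500 * (((φ.ν : ℝ) + 1) ^ 4 * (φ.size : ℝ) ^ 2) := by exact_mod_cast size_profile_le φ
    beta_reduce
    rw [d_profile, hm, Real.rpow_mul (by norm_num), Real.rpow_natCast]
    push_cast
    gcongr
  · rw [satisfiable_iff]
    rcases ha with ⟨h1, r, -, hr⟩ | ⟨h0, hr⟩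
    · exact Or.inl ⟨h1, r, hr⟩
    · exact Or.inr ⟨h0, fun ⟨r, h'⟩ => absurd h' (not_le.2 (hr r))⟩

end Reduction

theorem SAT.SolvableInTime.mono {k : ℕ} {T T' : SAT.Formula → ℝ} (h : SAT.SolvableInTime k T)
    (hT : ∀ φ, T φ ≤ T' φ) : SAT.SolvableInTime k T' := by
  obtain ⟨p, hp⟩ := h
  refine ⟨p, fun φ hφ => ?_⟩
  obtain ⟨τ, t, h, ht, ha⟩ := hp φ hφ
  exact ⟨τ, t, h, ht.trans (hT φ), ha⟩

theorem theorem1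
    (h : ∃ ε : ℝ, 0 < ε ∧ ∃ C c : ℕ,
      CMS.SolvableInTime fun P s =>
        C * (P.d : ℝ) ^ ((1 - ε) * (P.m : ℝ)) * (P.size s : ℝ) ^ c) :
    ¬ SETH := by
  obtain ⟨ε, hε, C, c, h⟩ := h
  intro hS
  have hβ2 : (2 : ℝ) ^ (1 - ε) < 2 := by
    have := Real.rpow_lt_rpow_of_exponent_lt (x := 2) (by norm_num) (show 1 - ε < 1 by linarith)
    simpa using this
  have hβ0 : (0 : ℝ) < 2 ^ (1 - ε) := by positivity
  -- For `ε > 1` the base is below `1`; with `β ≥ 1` the additive cost of the reduction is also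
  -- bounded by a multiple of `β ^ φ.ν`.
  obtain ⟨β, hββ, hβ1, hβ⟩ : ∃ β : ℝ, 2 ^ (1 - ε) ≤ β ∧ 1 ≤ β ∧ β < 2 :=
    ⟨max (2 ^ (1 - ε)) 1, le_max_left _ _, le_max_right _ _, max_lt hβ2 (by norm_num)⟩
  -- The new base is the midpoint of `β` and `2`.
  obtain ⟨D, hD⟩ := Reduction.exists_pow_mul_pow_le (β := β) (γ := 2 - (2 - β) / 2) (by linarith)
    (by linarith) (4 * (c + 1))
  obtain ⟨k, hk⟩ := hS ((2 - β) / 2) (by linarith)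
  refine hk ⟨(31200 + 4 * C * 500 ^ c) * D, 2 * (c + 1),
    (Reduction.solvableInTime_of_cms h k).mono fun φ => ?_⟩
  have hS1 : (1 : ℝ) ≤ φ.size := by
    exact_mod_cast (Nat.zero_le _).trans_lt (Reduction.length_tokens_lt_size φ)
  have hN1 : (1 : ℝ) ≤ (φ.ν : ℝ) + 1 := by
    have : (0 : ℝ) ≤ φ.ν := Nat.cast_nonneg _
    linarith
  have hD := hD φ.ν
  set N : ℝ := (φ.ν : ℝ) + 1
  set S : ℝ := (φ.size : ℝ)
  have hQ : 1 ≤ N ^ 4 * S ^ 2 := one_le_mul_of_one_le_of_one_le (one_le_pow₀ hN1) (one_le_pow₀ hS1)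
  have hβν : 1 ≤ β ^ φ.ν := one_le_pow₀ hβ1
  have hQc : N ^ 4 * S ^ 2 ≤ (N ^ 4 * S ^ 2) ^ (c + 1) := le_self_pow₀ hQ (by omega)
  have h1 : N ^ 3 * S ^ 2 ≤ (N ^ 4 * S ^ 2) ^ (c + 1) * β ^ φ.ν := by
    calc N ^ 3 * S ^ 2 ≤ N ^ 4 * S ^ 2 := by gcongr; norm_num
      _ ≤ (N ^ 4 * S ^ 2) ^ (c + 1) * 1 := by rw [mul_one]; exact hQc
      _ ≤ _ := by gcongr
  -- The two issues that are not variables cost a factor `β ^ 2 ≤ 4`.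
  have h2 : ((2 : ℝ) ^ (1 - ε)) ^ (φ.ν + 2) ≤ 4 * β ^ φ.ν := by
    calc ((2 : ℝ) ^ (1 - ε)) ^ (φ.ν + 2) ≤ β ^ (φ.ν + 2) := by gcongr
      _ = β ^ 2 * β ^ φ.ν := by ring
      _ ≤ 4 * β ^ φ.ν := by gcongr; nlinarith
  have h3 : (500 * (N ^ 4 * S ^ 2)) ^ c ≤ 500 ^ c * (N ^ 4 * S ^ 2) ^ (c + 1) := by
    rw [mul_pow]
    gcongr
    omega
  calc 31200 * (N ^ 3 * S ^ 2) +
        C * ((2 : ℝ) ^ (1 - ε)) ^ (φ.ν + 2) * (500 * (N ^ 4 * S ^ 2)) ^ c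
      ≤ 31200 * ((N ^ 4 * S ^ 2) ^ (c + 1) * β ^ φ.ν) +
        C * (4 * β ^ φ.ν) * (500 ^ c * (N ^ 4 * S ^ 2) ^ (c + 1)) := by gcongr
    _ = (31200 + 4 * C * 500 ^ c) * (N ^ (4 * (c + 1)) * β ^ φ.ν) * S ^ (2 * (c + 1)) := by
      rw [mul_pow, ← pow_mul, ← pow_mul]; ring
    _ ≤ (31200 + 4 * C * 500 ^ c) * (D * (2 - (2 - β) / 2) ^ φ.ν) * S ^ (2 * (c + 1)) := by
      gcongr
    _ = _ := by push_cast; ring
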